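/- **Cost model.** Memory is an array of cells. For real $M,B>0$, cut the array into contiguous blocks of $B$ cells (cell $a\ge 0$ lies in block $\lfloor a/B\rfloor$). In a sequence of cell accesses, an access costs $0$ if its block is among the $\lfloor M/B\rfloor$ most recently accessed blocks, and $1$ otherwise. For a sequence $X$ of cell indices, let $T_X(M,B)$ be the total cost of the accesses $\mathrm{Read}(i)$, $i\in X$, if no block has been accessed before (empty memory): this is the ephemeral time of $X$. **The structure.** Fix $0<\varepsilon<1$. The *ST-tree structure* stores the history of an array $A$ under operations $\mathrm{Write}(i,x)$; the $v$-th write creates version $v$, and $V$ is the number of writes. $U$ is a power of two exceeding all cell indices written so far; it starts at $1$, and when it is too small it is doubled as often as necessary and everything is rebuilt from a log of all writes. A write to cell $i$ at time $v$ is the point $(i,v)$ of space-time. Tree number $j=0,1,\dots$ covers columns $0,\dots,U-1$ and versions $jU+1,\dots,(j+1)U$; the last tree (top tree) is open towards the future, the others are the bottom trees. * In an ST-tree, a node of height $h$ has a rectangle of width $2^h$, which is partitioned by the rectangles of its two children (left and right half) or three children (left, right, and an upper one on top of one of the other two). A leaf is full if its rectangle contains a point; an internal node is full if it has two full children. * A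 new top tree is a complete binary tree of height $\log_2U$ with open rectangles and with leaf values copied from the current array. A write at time $v$ puts its point into the open leaf of its column. Let $q$ be the highest ancestor (or self) of this leaf that thereby becomes full; if $q$ has a parent, then the parent has two children, all open rectangles in the subtree of $q$ are closed at time $v$, and a complete binary tree of the height of $q$ with open rectangles starting at $v+1$, its leaf values copied from the current array, becomes the third child of the parent, on top of $q$. After every $U$ writes the top tree is closed and becomes a bottom tree, and a new top tree is begun. * Each node is a record of constantly many consecutive words: pointers to children and parent, coordinates of the rectangle, a mark for being full, and in a leaf its point and the value at the bottom of its rectangle. The top tree is stored as a complete 3-ary tree with $\log_2U+1$ levels in the biased van Emde Boas layout: a tree with $n\ge2$ levels is cut into a top tree with $a=\max(1,\lfloor\varepsilon n\rfloor)$ levels, stored first, and $3^{a}$ bottom trees with $n-a$ levels, stored after it from left to right, each part recursively. A bottom tree of the structure is stored with its existing nodes only, in the same order. The place of each tree and of the array of pointers to the trees in memory is arbitrary. * $\mathrm{Persistent\text{-}Read}(v,i)$ returns the value of cell $i$ in version $v$. It starts from a pointer $p$ to the leaf reached by the previous persistent read and moves $p$ up to the first node whose rectangle contains $(i,v)$;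 if there is none up to the root, $p$ is set to the root of tree number $\lfloor (v-1)/U\rfloor$, found in the array of trees. Then $p$ is moved down to the leaf containing $(i,v)$: at each node the child in the half of column $i$ is examined first, and the upper child only if that one does not contain $(i,v)$. Its cost counts the accesses to all words of the records examined and to the global variables and the array of trees. **Theorem.** Let $0<\varepsilon<1$ and $\theta=\frac{1-\varepsilon}{\log_2 3}$. There is a constant $c\ge1$, depending only on $\varepsilon$, such that the following holds for every sequence of $V$ writes, every version $1\le v\le V$, every finite sequence $X$ of cells in $\{0,\dots,U-1\}$, all integers $B\ge 2$ and $M\ge B$, every leaf at which $p$ may initially point, and every sequence of earlier memory accesses. In the ST-tree structure produced by the writes, the persistent reads $\mathrm{Persistent\text{-}Read}(v,i)$, $i\in X$, executed one after the other on a machine with memory $M$ and block size $B$, take time at most $$c\cdot T_X\!\left(\frac{M}{3c\,B^{1-\theta}(1+\log_BU)},\;B^{\theta}\right)\cdot(1+\log_BU).$$ -/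

import Mathlib

namespace COPersistence

-- The cost model.

/-- The array of cells is cut into contiguous blocks of `B` cells; the block of cell `a`.
The block size is a positive real number, since block sizes such as `B ^ θ` occur. -/
noncomputable def blockOf (B : ℝ) (a : ℕ) : ℕ := ⌊(a : ℝ) / B⌋₊

/-- The blocks touched so far, without repetition, most recent first, after one more access
to the block `b`. -/
def touch (recent : List ℕ) (b : ℕ) : List ℕ := b :: recent.erase b

/-- Number of accesses, in a sequence of accesses to blocks, that go to a block which is not among
the `K` most recently accessed ones; `recent` lists the blocks accessed before the sequence. -/
def lruCost (K : ℕ) : List ℕ → List ℕ → ℕ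
  | _, [] => 0
  | recent, b :: bs => (if b ∈ recent.take K then 0 else 1) + lruCost K (touch recent b) bs

/-- Number of block transfers of the cell accesses `accesses` on a machine with memory `M` and
block size `B`, if the cells `before` have been accessed before (`before = []`: the memory is
empty at the start). An access is free if it goes to one of the `⌊M / B⌋` most recently accessed
blocks, and costs one otherwise. -/
noncomputable def runtime (M B : ℝ) (before accesses : List ℕ) : ℕ :=
  lruCost ⌊M / B⌋₊ ((before.map (blockOf B)).foldl touch []) (accesses.map (blockOf B))

/-- Ephemeral time of the operations `Read i`, `i ∈ X`, from an empty memory: the ephemeral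
structure accesses exactly the cells of `X`. -/
noncomputable def ephemeralTime (X : List ℕ) (M B : ℝ) : ℕ := runtime M B [] X

-- Space-time trees.

/-- A space-time rectangle: the columns `left, …, left + width - 1` and the versions from `bot`
to `top`, both included; `top = none` means that it is open towards the future. -/
structure Rect where
  left : ℕ
  width : ℕ
  bot : ℕ
  top : Option ℕ

namespace Rect

def Contains (r : Rect) (i v : ℕ) : Prop :=
  r.left ≤ i ∧ i < r.left + r.width ∧ r.bot ≤ v ∧ ∀ t ∈ r.top, v ≤ t

instance (r : Rect) (i v : ℕ) : Decidable (r.Contains i v) := by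
  unfold Contains; infer_instance

/-- Column `i` belongs to the left half of the rectangle. -/
def InLeftHalf (r : Rect) (i : ℕ) : Prop := i < r.left + r.width / 2

instance (r : Rect) (i : ℕ) : Decidable (r.InLeftHalf i) := by
  unfold InLeftHalf; infer_instance

/-- An open rectangle gets the top side `v`; a closed one stays as it is. -/
def close (v : ℕ) (r : Rect) : Rect := { r with top := some (r.top.getD v) }

end Rect

/-- ST-trees. A leaf has a rectangle of width one; it stores the at most one write (version and
label) whose point lies in its rectangle, and the value of its cell before that write. An internal
node has a left and a right child, and possibly a third child, the upper one. -/
inductive STTree (α : Type*) where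
  | leaf (r : Rect) (point : Option (ℕ × α)) (val : α) : STTree α
  | node2 (r : Rect) (l m : STTree α) : STTree α
  | node3 (r : Rect) (l m u : STTree α) : STTree α

/-- A node of a tree is named by the way from it up to the root; each entry says which child
(0 left, 1 right, 2 upper) one comes from. The root is `[]`, the left child of `q` is `0 :: q`. -/
abbrev Pos := List (Fin 3)

namespace STTree

variable {α : Type*}

def rect : STTree α → Rect
  | leaf r _ _ => r
  | node2 r _ _ => r
  | node3 r _ _ _ => r

def height : STTree α → ℕ
  | leaf _ _ _ => 0
  | node2 _ l _ => l.height + 1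
  | node3 _ l _ _ => l.height + 1

/-- A leaf is full if it contains a point, an internal node if it has two full children. -/
def isFull : STTree α → Bool
  | leaf _ point _ => point.isSome
  | node2 _ l m => l.isFull && m.isFull
  | node3 _ l m u =>
      (l.isFull && m.isFull) || (l.isFull && u.isFull) || (m.isFull && u.isFull)

/-- Closing at version `v` all rectangles of the tree that are open. -/
def close (v : ℕ) : STTree α → STTree α
  | leaf r point val => leaf (r.close v) point val
  | node2 r l m => node2 (r.close v) (l.close v) (m.close v)
  | node3 r l m u => node3 (r.close v) (l.close v) (m.close v) (u.close v)

/-- The complete binary tree of a given height whose first column is `left`, with open rectangles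
that begin at version `bot` and with the values in its leaves copied from the array `C`. -/
def complete (C : ℕ → α) (bot : ℕ) : (height : ℕ) → (left : ℕ) → STTree α
  | 0, left => leaf ⟨left, 1, bot, none⟩ none (C left)
  | h + 1, left => node2 ⟨left, 2 ^ (h + 1), bot, none⟩
      (complete C bot h left) (complete C bot h (left + 2 ^ h))

/-- Adding the point `(i, v)` with label `x` above all points of the tree, and the reconfiguration;
`C` is the current array after the write. If a child with only one sibling has become full, then
its subtree is closed and a third child is put on top of it. If a child with two siblings has
become full, then its parent has become full as well, which is dealt with one level higher. -/
def insert (C : ℕ → α) (v i : ℕ) (x : α) : STTree α → STTree α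
  | leaf r _ val => leaf r (some (v, x)) val
  | node2 r l m =>
      if r.InLeftHalf i then
        let l₁ := l.insert C v i x
        if l₁.isFull then
          node3 r (l₁.close v) m (complete C (v + 1) l.height l.rect.left)
        else node2 r l₁ m
      else
        let m₁ := m.insert C v i x
        if m₁.isFull then
          node3 r l (m₁.close v) (complete C (v + 1) m.height m.rect.left)
        else node2 r l m₁
  | node3 r l m u =>
      if r.InLeftHalf i then
        if l.rect.top.isNone then node3 r (l.insert C v i x) m u
        else node3 r l m (u.insert C v i x)
      else
        if m.rect.top.isNone then node3 r l (m.insert C v i x) u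
        else node3 r l m (u.insert C v i x)

/-- The subtree reached from the root by the directions in the list, first one first. -/
def follow : STTree α → List (Fin 3) → Option (STTree α)
  | t, [] => some t
  | leaf _ _ _, _ :: _ => none
  | node2 _ l m, d :: ds => if d = 0 then l.follow ds else if d = 1 then m.follow ds else none
  | node3 _ l m u, d :: ds =>
      if d = 0 then l.follow ds else if d = 1 then m.follow ds else u.follow ds

/-- The subtree at a node. -/
def at? (t : STTree α) (q : Pos) : Option (STTree α) := t.follow q.reverse

/-- The nodes of the tree, as descendants of a node named `q`. -/
def nodesFrom : STTree α → Pos → List Pos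
  | leaf _ _ _, q => [q]
  | node2 _ l m, q => q :: (l.nodesFrom (0 :: q) ++ m.nodesFrom (1 :: q))
  | node3 _ l m u, q =>
      q :: (l.nodesFrom (0 :: q) ++ m.nodesFrom (1 :: q) ++ u.nodesFrom (2 :: q))

/-- All nodes of the tree. -/
def nodes (t : STTree α) : List Pos := t.nodesFrom []

def IsLeaf : STTree α → Prop
  | leaf _ _ _ => True
  | _ => False

/-- The rectangle of the node `q` contains `(i, v)`. -/
def holds (t : STTree α) (i v : ℕ) (q : Pos) : Bool :=
  match t.at? q with
  | some s => decide (s.rect.Contains i v)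
  | none => false

/-- Moving up from `q` to the first node whose rectangle contains `(i, v)`, or else to the root:
the nodes that are visited, `q` included, and the node where the walk ends. -/
def climb (t : STTree α) (i v : ℕ) : Pos → List Pos × Pos
  | [] => ([[]], [])
  | d :: q =>
      if t.holds i v (d :: q) then ([d :: q], d :: q)
      else ((d :: q) :: (climb t i v q).1, (climb t i v q).2)

/-- Moving down from the node `q`, the root of the given subtree, to the leaf that contains
`(i, v)`: the nodes examined below `q`, and the leaf. The rectangle of the current node tells the
column half; the third child is examined only if the child of that half does not contain
`(i, v)`. -/
def descend (i v : ℕ) : STTree α → Pos → List Pos × Pos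
  | leaf _ _ _, q => ([], q)
  | node2 r l m, q =>
      if r.InLeftHalf i then
        ((0 :: q) :: (l.descend i v (0 :: q)).1, (l.descend i v (0 :: q)).2)
      else ((1 :: q) :: (m.descend i v (1 :: q)).1, (m.descend i v (1 :: q)).2)
  | node3 r l m u, q =>
      if r.InLeftHalf i then
        if l.rect.Contains i v then
          ((0 :: q) :: (l.descend i v (0 :: q)).1, (l.descend i v (0 :: q)).2)
        else ((0 :: q) :: (2 :: q) :: (u.descend i v (2 :: q)).1, (u.descend i v (2 :: q)).2)
      else
        if m.rect.Contains i v then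
          ((1 :: q) :: (m.descend i v (1 :: q)).1, (m.descend i v (1 :: q)).2)
        else ((1 :: q) :: (2 :: q) :: (u.descend i v (2 :: q)).1, (u.descend i v (2 :: q)).2)

end STTree

-- The global structure.

/-- The persistent structure: `U = 2 ^ logU`, the number `vers` of writes so far, the log of all
writes, the current array, the bottom trees in order of time, and the top tree. Tree number `j`
(counted from 0) is responsible for the versions `j * U + 1, …, (j + 1) * U`. -/
structure Store (α : Type*) where
  logU : ℕ
  vers : ℕ
  log : List (ℕ × α)
  cur : ℕ → α
  bottom : List (STTree α)
  top : STTree α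

/-- A pointer to a node of the structure: the number of its tree and the node of this tree. -/
structure Pointer where
  tree : ℕ
  pos : Pos

/-- An access of a persistent read to a part of the structure. -/
inductive Access where
  /-- the global variable that holds the pointer `p` -/
  | pointer : Access
  /-- the global variable that holds `U` -/
  | size : Access
  /-- entry `j` of the array of trees -/
  | entry (j : ℕ) : Access
  /-- the record of a node -/
  | record (p : Pointer) : Access

namespace Store

variable {α : Type*}

def U (S : Store α) : ℕ := 2 ^ S.logU

/-- The structure before the first write; all cells hold the default value. -/
def init [Inhabited α] (logU : ℕ) : Store α where
  logU := logU
  vers := 0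
  log := []
  cur := fun _ => default
  bottom := []
  top := STTree.complete (fun _ => default) 1 logU 0

/-- After every `U` writes the top tree is closed and becomes a bottom tree, and the next write
begins with a new top tree, a complete binary tree filled from the current array. -/
def refresh (S : Store α) : Store α :=
  if 0 < S.vers ∧ S.U ∣ S.vers then
    { S with
      bottom := S.bottom ++ [S.top.close S.vers]
      top := STTree.complete S.cur (S.vers + 1) S.logU 0 }
  else S

/-- `Write(i, x)` for `i < U`. -/
def writeIn (S : Store α) (w : ℕ × α) : Store α :=
  let R := S.refresh
  let C := Function.update R.cur w.1 w.2
  { R with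
    vers := R.vers + 1
    log := R.log ++ [w]
    cur := C
    top := R.top.insert C (R.vers + 1) w.1 w.2 }

/-- `Write(i, x)`. If `i` is not below `U`, then `U` is doubled until it is, all trees are
destroyed, and they are built again by executing all writes of the log. -/
def write [Inhabited α] (S : Store α) (w : ℕ × α) : Store α :=
  if w.1 < S.U then S.writeIn w
  else (S.log.foldl writeIn (init (Nat.clog 2 (w.1 + 1)))).writeIn w

/-- The structure after a sequence of writes, starting with `U = 1`. -/
def run [Inhabited α] (ws : List (ℕ × α)) : Store α := ws.foldl write (init 0)

/-- The array of ST-trees; the top tree is the last one. -/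
def trees (S : Store α) : List (STTree α) := S.bottom ++ [S.top]

/-- The subtree at a node of the structure. -/
def at? (S : Store α) (p : Pointer) : Option (STTree α) :=
  (S.trees[p.tree]?).bind fun t => t.at? p.pos

/-- `p` points to a leaf of one of the trees. -/
def IsLeaf (S : Store α) (p : Pointer) : Prop := ∃ t ∈ S.at? p, t.IsLeaf

/-- Moving down from the node `p` to the leaf containing `(i, v)`: the accesses and the leaf. -/
def goDown (S : Store α) (v i : ℕ) (p : Pointer) : List Access × Pointer :=
  match S.at? p with
  | some t =>
      ((t.descend i v p.pos).1.map fun q => Access.record ⟨p.tree, q⟩,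
        ⟨p.tree, (t.descend i v p.pos).2⟩)
  | none => ([], p)

/-- `Persistent-Read(v, i)` when `p` points to the leaf of the most recent persistent read: the
sequence of accesses, and the leaf that contains `(i, v)`, to which `p` points afterwards. First `p`
is moved up to a node whose rectangle contains `(i, v)`; if even the root does not qualify, `p` is
set to the root of the tree for version `v`, which is looked up in the array of trees; then `p` is
moved down to the leaf. -/
def persistentRead (S : Store α) (v i : ℕ) (p : Pointer) : List Access × Pointer :=
  match S.trees[p.tree]? with
  | none => ([], p)
  | some t =>
      let up := t.climb i v p.pos
      let upAccesses := up.1.map fun q => Access.record ⟨p.tree, q⟩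
      if t.holds i v up.2 then
        let down := S.goDown v i ⟨p.tree, up.2⟩
        ([Access.pointer] ++ upAccesses ++ down.1 ++ [Access.pointer], down.2)
      else
        let j := (v - 1) / S.U
        let down := S.goDown v i ⟨j, []⟩
        ([Access.pointer] ++ upAccesses ++ [Access.size, Access.entry j, Access.record ⟨j, []⟩] ++
          down.1 ++ [Access.pointer], down.2)

/-- The answer to `Persistent-Read(v, i)`, found in the leaf `p` that contains `(i, v)`. -/
def answer [Inhabited α] (S : Store α) (v : ℕ) (p : Pointer) : α :=
  match S.at? p with
  | some (STTree.leaf _ (some (w, x)) val) => if w ≤ v then x else val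
  | some (STTree.leaf _ none val) => val
  | _ => default

/-- The accesses of a sequence of persistent reads on version `v`, one after the other. -/
def persistentReads (S : Store α) (v : ℕ) : Pointer → List ℕ → List Access
  | _, [] => []
  | p, i :: X => (S.persistentRead v i p).1 ++ S.persistentReads v (S.persistentRead v i p).2 X

end Store

-- How the structure is stored in memory.

/-- Number of nodes of the complete 3-ary tree with `n` levels. -/
def ternarySize : ℕ → ℕ
  | 0 => 0
  | n + 1 => 3 * ternarySize n + 1

/-- Number of levels of the top part when a tree with `n ≥ 2` levels is cut: `ε * n`, rounded down,
but both parts get at least one level. -/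
noncomputable def topLevels (ε : ℝ) (n : ℕ) : ℕ := max 1 (min (n - 1) ⌊ε * n⌋₊)

/-- The number with the given digits in base 3, leading digit first. -/
def ternaryValue (ds : List (Fin 3)) : ℕ := ds.foldl (fun a d => 3 * a + d) 0

/-- Biased van Emde Boas layout of the complete 3-ary tree with `n` levels: the place (from 0) of
the node reached from the root by the directions `ds`, `ds.length < n`. The tree is cut into a top
tree with `a = ε * n` levels and `3 ^ a` bottom trees with `n - a` levels; the top tree comes first,
followed by the bottom trees from left to right, each of them laid out recursively. -/
noncomputable def vebIndex (ε : ℝ) (n : ℕ) (ds : List (Fin 3)) : ℕ :=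
  if _h : n ≤ 1 then 0
  else if ds.length < topLevels ε n then vebIndex ε (topLevels ε n) ds
  else ternarySize (topLevels ε n) +
    ternaryValue (ds.take (topLevels ε n)) * ternarySize (n - topLevels ε n) +
    vebIndex ε (n - topLevels ε n) (ds.drop (topLevels ε n))
termination_by n
decreasing_by
  all_goals (unfold topLevels; omega)

/-- Words in the record of a node: the pointers to the three children and the parent, the four
coordinates of the rectangle, the mark for being full, and, for leaves, version and label of the
point and the value at the bottom of the rectangle. -/
def recordWords : ℕ := 12

/-- Where the parts of the structure lie in memory: the global variables, the array of trees, and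
the `j`-th tree. No relation between these addresses is needed. (The log and the current array
are not accessed by persistent reads.) -/
structure Placement where
  globals : ℕ
  table : ℕ
  tree : ℕ → ℕ

namespace Store

variable {α : Type*}

/-- Place of a node among the records of its tree. The top tree has room for a complete 3-ary tree;
in a bottom tree only the existing nodes are stored, in the same order. -/
noncomputable def recordIndex (S : Store α) (ε : ℝ) (p : Pointer) : ℕ :=
  if p.tree < S.bottom.length then
    ((S.bottom[p.tree]?).elim [] STTree.nodes).countP fun q =>
      decide (vebIndex ε (S.logU + 1) q.reverse < vebIndex ε (S.logU + 1) p.pos.reverse)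
  else vebIndex ε (S.logU + 1) p.pos.reverse

/-- The memory cells read or written in an access; the record of a node is read as a whole. -/
noncomputable def cells (S : Store α) (ε : ℝ) (A : Placement) : Access → List ℕ
  | Access.pointer => [A.globals]
  | Access.size => [A.globals + 1]
  | Access.entry j => [A.table + j]
  | Access.record p =>
      (List.range recordWords).map fun k => A.tree p.tree + recordWords * S.recordIndex ε p + k

/-- Time, on a machine with memory `M` and block size `B`, of the persistent reads `X` on version
`v` in the structure, where `p` points to the leaf of the last persistent read before, and `before`
lists the cells accessed by earlier operations. -/
noncomputable def persistentTime (S : Store α) (ε : ℝ) (A : Placement) (p : Pointer)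
    (before : List ℕ) (v : ℕ) (X : List ℕ) (M B : ℝ) : ℕ :=
  runtime M B before ((S.persistentReads v p X).flatMap (S.cells ε A))

end Store

end COPersistence

open COPersistence

namespace COPersistence

/-! ### Least recently used caches -/

/-! All columns of version `v` lie in one ST-tree. After the first read, `p` is the leaf of the
preceding column `i`, and a read of `x` climbs from that leaf and descends to the leaf of `x`
without leaving the tree. It therefore touches, apart from `p` itself, only records on the two
root-to-leaf paths and children of nodes on them.

Layout. Stop the recursive cutting as soon as all parts have at most N ≈ log₃ B levels. A part is
contiguous and has fewer than 3^N ≤ 2B records, hence meets O(1) blocks; a path meets m = O(1 +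
log_B U) parts, since each cut leaves both pieces a constant fraction of the levels. Compacting a
bottom tree replaces places by ranks, which keeps the order and does not increase distances. The
bias of the cuts gives the lowest parts about (1 - ε) N levels, so their roots span at least B^θ / 4
columns (unless the whole tree is one part). Columns of one ephemeral block of size B^θ thus lie
below at most nine roots of lowest parts, and columns below the same root share all parts. So O(m)
memory blocks can be charged to each ephemeral block (`card_columnBlocks_le`,
`IsValid.leafBlocks_subset_columnBlocks`), and a read touches only blocks charged to its own or to
the preceding column.

Caching (`lruCost_chainAccesses_le`). Let K' be the cache size, in blocks, of the ephemeral machine,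
and cut the ephemeral sequence into phases of K' fetches. A phase involves at most 2K' + 1 ≤ 3K'
ephemeral blocks, counting the one of the preceding column, hence 3K' · O(m) memory blocks. These
fit into the persistent cache, and LRU fetches each of them at most once per phase. So every
ephemeral fetch pays for O(m) persistent ones.

Tiny caches. If K' = 0, every ephemeral read costs one, and a single read must cost O(m) even with
room for only one block. The same bound is needed for the first read, which starts at an arbitrary
leaf. It holds because the climb runs strictly backwards and the descent strictly forwards through
the layout, so a block that is left is not entered again (`lruCost_records_le_card`). -/

theorem lruCost_append (K : ℕ) (xs ys : List ℕ) (r : List ℕ) :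
    lruCost K r (xs ++ ys) = lruCost K r xs + lruCost K (xs.foldl touch r) ys := by
  induction xs generalizing r with
  | nil => simp [lruCost]
  | cons x xs ih => simp [lruCost, ih, add_assoc]

theorem lruCost_le_length (K : ℕ) (xs r : List ℕ) : lruCost K r xs ≤ xs.length := by
  induction xs generalizing r with
  | nil => simp [lruCost]
  | cons x xs ih =>
    have := ih (touch r x)
    simp only [lruCost, List.length_cons]
    split_ifs <;> omega

theorem lruCost_zero (xs r : List ℕ) : lruCost 0 r xs = xs.length := by
  induction xs generalizing r with
  | nil => simp [lruCost]
  | cons x xs ih => simp [lruCost, ih, add_comm]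

/-- Potential argument: `pre` holds the blocks accessed since the start, which are always the front
of the recency list. As it never outgrows `D`, it stays inside the cache. -/
theorem lruCost_add_length_le_card {K : ℕ} {D : Finset ℕ} (hK : D.card ≤ K) (xs pre rest : List ℕ)
    (hx : ∀ x ∈ xs, x ∈ D) (hpre : pre.Nodup) (hD : ∀ x ∈ pre, x ∈ D) :
    lruCost K (pre ++ rest) xs + pre.length ≤ D.card := by
  induction xs generalizing pre rest with
  | nil =>
    have := Finset.card_le_card (s := pre.toFinset) (t := D) (by intro x; simpa using hD x)
    rw [List.toFinset_card_of_nodup hpre] at this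
    simpa [lruCost] using this
  | cons b xs ih =>
    have hlen : pre.length ≤ D.card := by
      rw [← List.toFinset_card_of_nodup hpre]
      exact Finset.card_le_card (by intro x; simpa using hD x)
    have hx' : ∀ x ∈ xs, x ∈ D := fun x h => hx x (List.mem_cons_of_mem _ h)
    have hb : b ∈ D := hx b List.mem_cons_self
    by_cases h : b ∈ pre
    -- A hit: the access only permutes `pre`.
    · have h1 : b ∈ (pre ++ rest).take K := by
        rw [List.take_append]
        rw [List.take_of_length_le (by omega)]
        simp [h]
      have := ih (b :: pre.erase b) rest hx'
        (List.nodup_cons.2 ⟨fun h' => (List.Nodup.mem_erase_iff hpre).1 h' |>.1 rfl,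
          hpre.erase b⟩)
        (by
          intro x hx
          rcases List.mem_cons.1 hx with rfl | hx
          · exact hb
          · exact hD x (List.mem_of_mem_erase hx))
      have h2 : (pre.erase b).length + 1 = pre.length := by
        rw [List.length_erase_of_mem h]
        have := List.length_pos_of_mem h
        omega
      simp only [lruCost, if_pos h1, touch, List.erase_append_left _ h]
      simp only [List.cons_append, List.length_cons] at this
      omega
    -- The access may cost one, but `pre` grows by one.
    · have := ih (b :: pre) (rest.erase b) hx' (List.nodup_cons.2 ⟨h, hpre⟩)
        (by
          intro x hx
          rcases List.mem_cons.1 hx with rfl | hx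
          · exact hb
          · exact hD x hx)
      simp only [lruCost, touch, List.erase_append_right _ h]
      simp only [List.cons_append, List.length_cons] at this
      split_ifs <;> omega

/-- A sequence of accesses to at most `K` different blocks fetches each of them at most once. -/
theorem lruCost_le_card {K : ℕ} {D : Finset ℕ} (hK : D.card ≤ K) (xs r : List ℕ)
    (hx : ∀ x ∈ xs, x ∈ D) : lruCost K r xs ≤ D.card := by
  simpa using lruCost_add_length_le_card hK xs [] r hx List.nodup_nil (by simp)

theorem take_erase_subset (l : List ℕ) (b k x : ℕ) (h : x ∈ (l.erase b).take k) :
    x ∈ l.take (k + 1) := by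
  induction l generalizing k with
  | nil => simp at h
  | cons a l ih =>
    rw [List.erase_cons] at h
    split_ifs at h with hab
    · exact List.mem_cons_of_mem _ h
    · cases k with
      | zero => simp at h
      | succ k =>
        rw [List.take_succ_cons, List.mem_cons] at h ⊢
        exact h.imp_right (ih k)

theorem take_touch_subset (l : List ℕ) (b K x : ℕ) (h : x ∈ (touch l b).take K) :
    x = b ∨ x ∈ l.take K := by
  cases K with
  | zero => simp at h
  | succ K =>
    rw [touch, List.take_succ_cons, List.mem_cons] at h
    exact h.imp_right (take_erase_subset l b K x)

/-- The blocks of a sequence which are not in the cache at the start have to be fetched. -/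
theorem card_sdiff_take_le_lruCost (K : ℕ) (xs r : List ℕ) :
    (xs.toFinset \ (r.take K).toFinset).card ≤ lruCost K r xs := by
  induction xs generalizing r with
  | nil => simp
  | cons b xs ih =>
    have h := ih (touch r b)
    simp only [lruCost]
    -- Accessing `b` brings nothing but `b` into the cache, so every other missing block is still
    -- missing afterwards.
    have hsub : ∀ x ∈ (b :: xs).toFinset \ (r.take K).toFinset,
        x ≠ b → x ∈ xs.toFinset \ ((touch r b).take K).toFinset := by
      intro x hx hxb
      simp only [Finset.mem_sdiff, List.mem_toFinset, List.mem_cons] at hx ⊢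
      refine ⟨hx.1.resolve_left hxb, fun h => ?_⟩
      rcases take_touch_subset r b K x h with h | h
      · exact hxb h
      · exact hx.2 h
    split_ifs with hb
    · refine le_trans (Finset.card_le_card fun x hx => hsub x hx ?_) (by omega)
      rintro rfl
      simp [hb] at hx
    · refine le_trans (Finset.card_le_card (t := insert b
        (xs.toFinset \ ((touch r b).take K).toFinset)) fun x hx => ?_)
        ((Finset.card_insert_le _ _).trans (by omega))
      by_cases hxb : x = b
      · simp [hxb]
      · exact Finset.mem_insert_of_mem (hsub x hx hxb)

/-- At most `K` of the blocks are in the cache at the start; each of the others has to be fetched.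
-/
theorem card_toFinset_le_add_lruCost (K : ℕ) (xs r : List ℕ) :
    xs.toFinset.card ≤ K + lruCost K r xs := by
  have h1 := card_sdiff_take_le_lruCost K xs r
  have h2 : (r.take K).toFinset.card ≤ K :=
    (List.toFinset_card_le _).trans (by simp)
  have h3 := Finset.card_le_card_sdiff_add_card (s := xs.toFinset) (t := (r.take K).toFinset)
  omega

/-- A sequence of fetches can be cut after any given number of them. -/
theorem exists_append_lruCost_eq (K k : ℕ) (f : ℕ → ℕ) (X r : List ℕ)
    (h : k ≤ lruCost K r (X.map f)) :
    ∃ Y Z, X = Y ++ Z ∧ lruCost K r (Y.map f) = k := by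
  induction X generalizing r k with
  | nil => exact ⟨[], [], rfl, by simp [lruCost] at h ⊢; omega⟩
  | cons x X ih =>
    rcases Nat.eq_zero_or_pos k with rfl | hk
    · exact ⟨[], x :: X, rfl, rfl⟩
    · simp only [List.map_cons, lruCost] at h
      obtain ⟨Y, Z, rfl, hY⟩ := ih (k - if f x ∈ r.take K then 0 else 1) (touch r (f x)) (by omega)
      refine ⟨x :: Y, Z, rfl, ?_⟩
      simp only [List.map_cons, lruCost, hY]
      split_ifs <;> omega

/-- The accesses of a sequence of operations, of which each depends on the argument of the
preceding one. -/
def chainAccesses (R : ℕ → ℕ → List ℕ) : ℕ → List ℕ → List ℕ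
  | _, [] => []
  | i, x :: X => R i x ++ chainAccesses R x X

theorem chainAccesses_append (R : ℕ → ℕ → List ℕ) (i : ℕ) (Y Z : List ℕ) :
    chainAccesses R i (Y ++ Z) =
      chainAccesses R i Y ++ chainAccesses R ((i :: Y).getLast (by simp)) Z := by
  induction Y generalizing i with
  | nil => simp [chainAccesses]
  | cons y Y ih => simp [chainAccesses, ih]

/-- Here and below, `e` sends a column to its ephemeral block, `F b` is the set of memory blocks
charged to the ephemeral block `b`, `R i x` lists the blocks accessed by the read of `x` after that
of `i`, and `P` restricts the columns to those below `U`. -/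
theorem mem_chainAccesses {R : ℕ → ℕ → List ℕ} {e : ℕ → ℕ} {F : ℕ → Finset ℕ} {P : ℕ → Prop}
    (hR : ∀ i x, P i → P x → ∀ y ∈ R i x, y ∈ F (e i) ∪ F (e x)) (i : ℕ) (X : List ℕ)
    (hi : P i) (hX : ∀ x ∈ X, P x) :
    ∀ y ∈ chainAccesses R i X, y ∈ ((i :: X).map e).toFinset.biUnion F := by
  induction X generalizing i with
  | nil => simp [chainAccesses]
  | cons x X ih =>
    intro y hy
    rw [chainAccesses, List.mem_append] at hy
    have hx := hX x List.mem_cons_self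
    rw [Finset.mem_biUnion]
    rcases hy with hy | hy
    · rcases Finset.mem_union.1 (hR i x hi hx y hy) with h | h
      · exact ⟨e i, by simp, h⟩
      · exact ⟨e x, by simp, h⟩
    · have := ih x hx (fun z hz => hX z (List.mem_cons_of_mem _ hz)) y hy
      rw [Finset.mem_biUnion] at this
      obtain ⟨b, hb, h⟩ := this
      refine ⟨b, ?_, h⟩
      rw [List.map_cons, List.toFinset_cons]
      exact Finset.mem_insert_of_mem hb

/-- The charged sets together fit into the cache, so each of their blocks is fetched at most once.
-/
theorem lruCost_chainAccesses_le_mul_card {R : ℕ → ℕ → List ℕ} {e : ℕ → ℕ} {F : ℕ → Finset ℕ}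
    {P : ℕ → Prop} (hR : ∀ i x, P i → P x → ∀ y ∈ R i x, y ∈ F (e i) ∪ F (e x)) {m K n : ℕ}
    (hF : ∀ i, P i → (F (e i)).card ≤ m) (i : ℕ) (X r : List ℕ)
    (hi : P i) (hX : ∀ x ∈ X, P x) (hn : ((i :: X).map e).toFinset.card ≤ n) (hK : n * m ≤ K) :
    lruCost K r (chainAccesses R i X) ≤ n * m := by
  have hcard : (((i :: X).map e).toFinset.biUnion F).card ≤ n * m := by
    refine (Finset.card_biUnion_le_card_mul _ _ m fun b hb => ?_).trans
      (Nat.mul_le_mul_right m hn)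
    simp only [List.mem_toFinset, List.mem_map] at hb
    obtain ⟨z, hz, rfl⟩ := hb
    refine hF z ?_
    rcases List.mem_cons.1 hz with rfl | hz
    · exact hi
    · exact hX z hz
  exact (lruCost_le_card (hcard.trans hK) _ r (mem_chainAccesses hR i X hi hX)).trans hcard

/-- If each operation accesses only the blocks which belong to its own argument or to the argument
of the preceding operation, then the arguments' fetches pay for the fetches of the operations. -/
theorem lruCost_chainAccesses_le {R : ℕ → ℕ → List ℕ} {e : ℕ → ℕ} {F : ℕ → Finset ℕ}
    {P : ℕ → Prop} (hR : ∀ i x, P i → P x → ∀ y ∈ R i x, y ∈ F (e i) ∪ F (e x)) {m K K' : ℕ}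
    (hF : ∀ i, P i → (F (e i)).card ≤ m) (hK' : 1 ≤ K') (hK : 3 * K' * m ≤ K)
    (i : ℕ) (X r r' : List ℕ) (hi : P i) (hX : ∀ x ∈ X, P x) :
    lruCost K r (chainAccesses R i X) ≤ 3 * m * lruCost K' r' (X.map e) + 3 * K' * m := by
  induction hs : X.length using Nat.strong_induction_on generalizing i X r r' with
  | _ s ih =>
  -- One phase: at most `K'` ephemeral blocks cached at its start, `K'` fetched ones, and `e i`;
  -- this makes `2 * K' + 1 ≤ 3 * K'` blocks.
  have key : ∀ (Y r r' : List ℕ), (∀ x ∈ Y, P x) → lruCost K' r' (Y.map e) ≤ K' →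
      lruCost K r (chainAccesses R i Y) ≤ 3 * K' * m := by
    intro Y r r' hY hle
    refine lruCost_chainAccesses_le_mul_card hR hF i Y r hi hY ?_ hK
    have h1 := card_toFinset_le_add_lruCost K' (Y.map e) r'
    have h2 := Finset.card_insert_le (e i) (Y.map e).toFinset
    rw [List.map_cons, List.toFinset_cons]
    omega
  by_cases hle : lruCost K' r' (X.map e) ≤ K'
  · exact (key X r r' hX hle).trans (Nat.le_add_left _ _)
  -- Split off a phase with exactly `K'` fetches. Its cost `3 * K' * m` is paid by these fetches at
  -- the rate `3 * m`, so only the last, incomplete phase contributes the additive term.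
  · obtain ⟨Y, Z, rfl, hY⟩ := exists_append_lruCost_eq K' K' e X r' (by omega)
    have hYne : Y ≠ [] := by
      rintro rfl
      simp [lruCost] at hY
      omega
    have hlen := List.length_pos_iff.2 hYne
    have hPY : ∀ x ∈ Y, P x := fun x h => hX x (List.mem_append_left _ h)
    have h1 := key Y r r' hPY hY.le
    have h2 := ih Z.length (by simp only [List.length_append] at hs; omega)
      ((i :: Y).getLast (by simp)) Z ((chainAccesses R i Y).foldl touch r)
      ((Y.map e).foldl touch r')
      (by
        rcases List.mem_cons.1 (List.getLast_mem (l := i :: Y) (by simp)) with h | h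
        · rw [h]; exact hi
        · exact hPY _ h)
      (fun x h => hX x (List.mem_append_right _ h)) rfl
    rw [chainAccesses_append, lruCost_append, List.map_append, lruCost_append, hY]
    calc _ ≤ 3 * K' * m + (3 * m * lruCost K' ((Y.map e).foldl touch r') (Z.map e)
          + 3 * K' * m) := Nat.add_le_add h1 h2
      _ = _ := by ring

/-- Serves the case of an ephemeral cache without any block, where each operation has to pay for
itself. -/
theorem lruCost_chainAccesses_le_mul_length {R : ℕ → ℕ → List ℕ} {P : ℕ → Prop} {m K : ℕ}
    (hR : ∀ i x, P i → P x → ∀ r, lruCost K r (R i x) ≤ m) (i : ℕ) (X r : List ℕ)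
    (hi : P i) (hX : ∀ x ∈ X, P x) : lruCost K r (chainAccesses R i X) ≤ m * X.length := by
  induction X generalizing i r with
  | nil => simp [chainAccesses, lruCost]
  | cons x X ih =>
    have hx := hX x List.mem_cons_self
    rw [chainAccesses, lruCost_append, List.length_cons]
    have h1 := hR i x hi hx r
    have h2 := ih x ((R i x).foldl touch r) hx fun z hz => hX z (List.mem_cons_of_mem _ hz)
    linarith

/-- Fetches of a sequence of operations, the first of which may start anywhere. -/
theorem lruCost_first_append_chainAccesses_le {R : ℕ → ℕ → List ℕ} {e : ℕ → ℕ}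
    {F : ℕ → Finset ℕ} {P : ℕ → Prop}
    (hR : ∀ i x, P i → P x → ∀ y ∈ R i x, y ∈ F (e i) ∪ F (e x)) {m m₀ K K' : ℕ}
    (hF : ∀ i, P i → (F (e i)).card ≤ m) (hR₀ : ∀ i x, P i → P x → ∀ r, lruCost K r (R i x) ≤ m₀)
    (hK : 3 * K' * m ≤ K) (first : List ℕ) (hfirst : ∀ r, lruCost K r first ≤ m₀)
    (i : ℕ) (X r : List ℕ) (hi : P i) (hX : ∀ x ∈ X, P x) :
    lruCost K r (first ++ chainAccesses R i X) ≤
      (m₀ + 6 * m) * lruCost K' [] ((i :: X).map e) := by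
  rw [lruCost_append]
  have h0 := hfirst r
  set r₁ := first.foldl touch r
  -- For `K' = 0` there are no ephemeral hits, so the ephemeral cost is the number of reads.
  rcases Nat.eq_zero_or_pos K' with rfl | hK'
  · rw [lruCost_zero, List.length_map, List.length_cons]
    have := lruCost_chainAccesses_le_mul_length hR₀ i X r₁ hi hX
    nlinarith
  · have hE : lruCost K' [] ((i :: X).map e) = 1 + lruCost K' [e i] (X.map e) := by
      simp [lruCost, touch]
    -- With few ephemeral fetches the additive term `3 * K' * m` cannot be afforded. But the
    -- ephemeral cache starts empty, so the number of distinct ephemeral blocks is at most the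
    -- number of fetches, and one phase suffices.
    by_cases hle : lruCost K' [] ((i :: X).map e) ≤ K'
    · have h1 := card_sdiff_take_le_lruCost K' ((i :: X).map e) []
      rw [List.take_nil, List.toFinset_nil, Finset.sdiff_empty] at h1
      have h2 := lruCost_chainAccesses_le_mul_card hR hF i X r₁ hi hX h1
        ((Nat.mul_le_mul_right m (hle.trans (by omega : K' ≤ 3 * K'))).trans hK)
      generalize lruCost K' [] ((i :: X).map e) = E at *
      have : 1 ≤ E := by omega
      nlinarith
    · have h2 := lruCost_chainAccesses_le hR hF hK' hK i X r₁ [e i] hi hX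
      generalize lruCost K' [] ((i :: X).map e) = E at *
      have h3 : lruCost K' [e i] (X.map e) ≤ E := by omega
      have h4 : 3 * m * lruCost K' [e i] (X.map e) ≤ 3 * m * E := Nat.mul_le_mul_left _ h3
      -- More than `K'` fetches absorb the additive term.
      have h5 : 3 * K' * m ≤ 3 * m * E := by
        rw [show 3 * K' * m = 3 * m * K' by ring]; exact Nat.mul_le_mul_left _ (by omega)
      have : 1 ≤ E := by omega
      nlinarith

/-! ### Monotone sequences of records -/

/-- The cells of a record of `w` words at address `a`. -/
def recordCells (w a : ℕ) : List ℕ := (List.range w).map fun k => a + k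

theorem lruCost_eq_zero_of_forall_eq {K : ℕ} (hK : 1 ≤ K) (b : ℕ) (r xs : List ℕ)
    (h : ∀ x ∈ xs, x = b) : lruCost K (b :: r) xs = 0 ∧
      ∃ r', xs.foldl touch (b :: r) = b :: r' := by
  induction xs generalizing r with
  | nil => exact ⟨rfl, r, rfl⟩
  | cons x xs ih =>
    obtain rfl := h x List.mem_cons_self
    have hx : x ∈ (x :: r).take K := by
      obtain ⟨k, rfl⟩ := Nat.exists_eq_add_of_le' hK
      simp
    have := ih r fun y hy => h y (List.mem_cons_of_mem _ hy)
    simpa [lruCost, hx, touch] using this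

/-- Number of changes of the value of `f` along a list. -/
def changes (f : ℕ → ℕ) : ℕ → List ℕ → ℕ
  | _, [] => 0
  | a, b :: l => (if f b = f a then 0 else 1) + changes f b l

/-- In a monotone sequence a value that has been left never returns, by antisymmetry; so each change
removes one element from `D`. The relation is `≤` on the way down and `≥` on the way up. -/
theorem changes_lt_card {f : ℕ → ℕ} {rel : ℕ → ℕ → Prop} [IsTrans ℕ rel] [Std.Antisymm rel]
    (D : Finset ℕ) (a : ℕ) (l : List ℕ) (hD : ∀ b ∈ a :: l, f b ∈ D)
    (h : (a :: l).Pairwise fun x y => rel (f x) (f y)) : changes f a l < D.card := by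
  induction l generalizing a D with
  | nil => exact Finset.card_pos.2 ⟨f a, hD a (by simp)⟩
  | cons b l ih =>
    obtain ⟨h1, h2⟩ := List.pairwise_cons.1 h
    rw [changes]
    split_ifs with hba
    · rw [zero_add]
      exact ih D b (fun c hc => hD c (List.mem_cons_of_mem _ hc)) h2
    · have := ih (D.erase (f a)) b (fun c hc => by
        refine Finset.mem_erase.2 ⟨fun hca => hba ?_, hD c (List.mem_cons_of_mem _ hc)⟩
        rcases List.mem_cons.1 hc with rfl | hc'
        · exact hca
        · have h3 := (List.pairwise_cons.1 h2).1 c hc'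
          rw [hca] at h3
          exact antisymm h3 (h1 b (by simp))) h2
      rw [Finset.card_erase_of_mem (hD a (by simp))] at this
      omega

theorem foldl_touch_append_singleton (xs r : List ℕ) (b : ℕ) :
    ∃ r', (xs ++ [b]).foldl touch r = b :: r' := by
  simp [List.foldl_append, touch]

theorem lruCost_records_le {K : ℕ} (hK : 1 ≤ K) (w : ℕ) {β : ℕ → ℕ} (hβ : Monotone β)
    {rel : ℕ → ℕ → Prop} (hrel : ∀ x y, rel x y → x + w < y ∨ y + w < x)
    (a : ℕ) (l r : List ℕ) (h : (a :: l).Pairwise rel)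
    (hr : ∃ r', r = β (a + w) :: r') :
    lruCost K r ((l.flatMap (recordCells (w + 1))).map β) ≤
      (w + 1) * (changes β a l + changes (fun x => β (x + w)) a l) := by
  induction l generalizing a r with
  | nil => simp [lruCost]
  | cons b l ih =>
    obtain ⟨r', rfl⟩ := hr
    obtain ⟨h1, h2⟩ := List.pairwise_cons.1 h
    rw [List.flatMap_cons, List.map_append, lruCost_append]
    have h3 := ih b (((recordCells (w + 1) b).map β).foldl touch (β (a + w) :: r')) h2 (by
      rw [recordCells, List.range_succ, List.map_append, List.map_append]
      exact foldl_touch_append_singleton _ _ _)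
    have h4 : lruCost K (β (a + w) :: r') ((recordCells (w + 1) b).map β) ≤
        (w + 1) * ((if β b = β a then 0 else 1) + if β (b + w) = β (a + w) then 0 else 1) := by
      by_cases h5 : β b = β a ∧ β (b + w) = β (a + w)
      -- The two records are disjoint, so one lies entirely before the other. If first blocks and
      -- last blocks agree, monotonicity makes all four blocks equal.
      · have h6 : β (b + w) = β b := by
          rcases hrel a b (h1 b (by simp)) with h | h
          · exact le_antisymm (by rw [h5.2]; exact hβ h.le) (hβ (by omega))
          · exact le_antisymm (by rw [h5.1]; exact hβ h.le) (hβ (by omega))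
        rw [(lruCost_eq_zero_of_forall_eq hK (β (a + w)) r' _ ?_).1]
        · exact Nat.zero_le _
        · intro x hx
          simp only [recordCells, List.mem_map, List.mem_range] at hx
          obtain ⟨_, ⟨k, hk, rfl⟩, rfl⟩ := hx
          rw [← h5.2]
          exact le_antisymm (hβ (by omega)) (by rw [h6]; exact hβ (by omega))
      · have := lruCost_le_length K ((recordCells (w + 1) b).map β) (β (a + w) :: r')
        simp only [recordCells, List.length_map, List.length_range] at this
        refine this.trans (Nat.le_mul_of_pos_right _ ?_)
        split_ifs <;> omega
    simp only [changes]
    linarith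

/-- Holds even for a cache of a single block. First words and last words each change their block
fewer than `D.card` times; the strictness pays for the first record. -/
theorem lruCost_records_le_card {K : ℕ} (hK : 1 ≤ K) (w : ℕ) {β : ℕ → ℕ} (hβ : Monotone β)
    (l r : List ℕ) (D : Finset ℕ) (hD : ∀ a ∈ l, ∀ k ≤ w, β (a + k) ∈ D)
    (h : (l.Pairwise fun x y => x + w < y) ∨ l.Pairwise fun x y => y + w < x) :
    lruCost K r ((l.flatMap (recordCells (w + 1))).map β) ≤ 2 * (w + 1) * D.card := by
  cases l with
  | nil => simp [lruCost]
  | cons a l =>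
    have h1 : lruCost K (((recordCells (w + 1) a).map β).foldl touch r)
        ((l.flatMap (recordCells (w + 1))).map β) ≤
        (w + 1) * (changes β a l + changes (fun x => β (x + w)) a l) := by
      have hr : ∃ r', ((recordCells (w + 1) a).map β).foldl touch r = β (a + w) :: r' := by
        rw [recordCells, List.range_succ, List.map_append, List.map_append]
        exact foldl_touch_append_singleton _ _ _
      rcases h with h | h
      · exact lruCost_records_le hK w hβ (fun x y h => Or.inl h) a l _ h hr
      · exact lruCost_records_le hK w hβ (fun x y h => Or.inr h) a l _ h hr
    have h2 : changes β a l < D.card ∧ changes (fun x => β (x + w)) a l < D.card := by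
      have hD0 : ∀ b ∈ a :: l, β b ∈ D := fun b hb => hD b hb 0 (Nat.zero_le _)
      have hDw : ∀ b ∈ a :: l, β (b + w) ∈ D := fun b hb => hD b hb w le_rfl
      rcases h with h | h
      · exact ⟨changes_lt_card (rel := (· ≤ ·)) D a l hD0 (h.imp fun h => hβ (by omega)),
          changes_lt_card (rel := (· ≤ ·)) D a l hDw (h.imp fun h => hβ (by omega))⟩
      · exact ⟨changes_lt_card (rel := (· ≥ ·)) D a l hD0 (h.imp fun h => hβ (by omega)),
          changes_lt_card (rel := (· ≥ ·)) D a l hDw (h.imp fun h => hβ (by omega))⟩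
    have h3 := lruCost_le_length K ((recordCells (w + 1) a).map β) r
    rw [List.flatMap_cons, List.map_append, lruCost_append]
    simp only [recordCells, List.length_map, List.length_range] at h3
    have h4 : (w + 1) * (changes β a l + changes (fun x => β (x + w)) a l) + (w + 1) ≤
        2 * (w + 1) * D.card := by
      have : changes β a l + changes (fun x => β (x + w)) a l + 1 ≤ 2 * D.card := by omega
      calc _ = (w + 1) * (changes β a l + changes (fun x => β (x + w)) a l + 1) := by ring
        _ ≤ (w + 1) * (2 * D.card) := Nat.mul_le_mul_left _ this
        _ = _ := by ring
    simp only [recordCells] at h1 h3 ⊢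
    omega

end COPersistence

namespace COPersistence

/-! ### The biased van Emde Boas layout -/

theorem two_mul_ternarySize_add_one (n : ℕ) : 2 * ternarySize n + 1 = 3 ^ n := by
  induction n with
  | zero => rfl
  | succ n ih => rw [ternarySize, pow_succ]; omega

theorem ternarySize_mono : Monotone ternarySize :=
  monotone_nat_of_le_succ fun n => by rw [ternarySize]; omega

theorem ternarySize_pos {n : ℕ} (h : 1 ≤ n) : 1 ≤ ternarySize n :=
  ternarySize_mono h

theorem ternarySize_lt_pow (n : ℕ) : ternarySize n < 3 ^ n := by
  have := two_mul_ternarySize_add_one n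
  omega

theorem ternarySize_add (a b : ℕ) :
    ternarySize (a + b) = ternarySize a + 3 ^ a * ternarySize b := by
  have h1 := two_mul_ternarySize_add_one a
  have h2 := two_mul_ternarySize_add_one b
  have h3 := two_mul_ternarySize_add_one (a + b)
  rw [pow_add, ← h1, ← h2] at h3
  rw [← h1]
  nlinarith

theorem ternaryValue_append_singleton (ds : List (Fin 3)) (e : Fin 3) :
    ternaryValue (ds ++ [e]) = 3 * ternaryValue ds + e := by
  simp [ternaryValue, List.foldl_append]

theorem ternaryValue_lt_pow (ds : List (Fin 3)) : ternaryValue ds < 3 ^ ds.length := by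
  induction ds using List.reverseRecOn with
  | nil => simp [ternaryValue]
  | append_singleton ds e ih =>
    rw [ternaryValue_append_singleton, List.length_append, List.length_singleton, pow_succ]
    omega

theorem ternaryValue_injective {ds ds' : List (Fin 3)} (hl : ds.length = ds'.length)
    (h : ternaryValue ds = ternaryValue ds') : ds = ds' := by
  induction ds using List.reverseRecOn generalizing ds' with
  | nil => exact (List.length_eq_zero_iff.1 hl.symm).symm
  | append_singleton ds e ih =>
    induction ds' using List.reverseRecOn with
    | nil => simp at hl
    | append_singleton ds' e' _ =>
      rw [ternaryValue_append_singleton, ternaryValue_append_singleton] at h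
      rw [ih (by simpa using hl) (by omega), Fin.ext (by omega : (e : ℕ) = e')]

variable {ε : ℝ}

theorem one_le_topLevels (ε : ℝ) (n : ℕ) : 1 ≤ topLevels ε n := le_max_left _ _

theorem topLevels_lt (ε : ℝ) {n : ℕ} (h : 1 < n) : topLevels ε n < n := by
  unfold topLevels; omega

theorem vebIndex_of_le_one {n : ℕ} (h : n ≤ 1) (ds : List (Fin 3)) : vebIndex ε n ds = 0 := by
  rw [vebIndex, dif_pos h]

theorem vebIndex_of_lt {n : ℕ} (h : 1 < n) {ds : List (Fin 3)} (hd : ds.length < topLevels ε n) :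
    vebIndex ε n ds = vebIndex ε (topLevels ε n) ds := by
  rw [vebIndex, dif_neg (by omega), if_pos hd]

theorem vebIndex_of_le {n : ℕ} (h : 1 < n) {ds : List (Fin 3)} (hd : topLevels ε n ≤ ds.length) :
    vebIndex ε n ds = ternarySize (topLevels ε n) +
      ternaryValue (ds.take (topLevels ε n)) * ternarySize (n - topLevels ε n) +
      vebIndex ε (n - topLevels ε n) (ds.drop (topLevels ε n)) := by
  rw [vebIndex, dif_neg (by omega), if_neg (by omega)]

theorem vebIndex_nil (n : ℕ) : vebIndex ε n [] = 0 := by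
  induction n using Nat.strong_induction_on with
  | _ n ih =>
    rcases Nat.lt_or_ge 1 n with h | h
    · rw [vebIndex_of_lt (ds := []) h (one_le_topLevels ε n), ih _ (topLevels_lt ε h)]
    · exact vebIndex_of_le_one h _

theorem vebIndex_lt_ternarySize {n : ℕ} {ds : List (Fin 3)} (hd : ds.length < n) :
    vebIndex ε n ds < ternarySize n := by
  induction n using Nat.strong_induction_on generalizing ds with
  | _ n ih =>
    rcases Nat.lt_or_ge 1 n with h | h
    · have ha := topLevels_lt ε h
      have ha' := one_le_topLevels ε n
      set a := topLevels ε n with ha_def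
      rcases Nat.lt_or_ge ds.length a with h1 | h1
      · rw [vebIndex_of_lt h h1]
        exact (ih a ha h1).trans_le (ternarySize_mono ha.le)
      · rw [vebIndex_of_le h h1, ← ha_def]
        have h2 := ih (n - a) (by omega) (ds := ds.drop a) (by rw [List.length_drop]; omega)
        have h3 := ternaryValue_lt_pow (ds.take a)
        rw [List.length_take_of_le h1] at h3
        have h4 := ternarySize_add a (n - a)
        rw [Nat.add_sub_cancel' ha.le] at h4
        have h5 := Nat.mul_le_mul_right (ternarySize (n - a)) (Nat.succ_le_of_lt h3)
        rw [Nat.succ_mul] at h5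
        omega
    · rw [vebIndex_of_le_one h]
      exact ternarySize_pos (by omega)

/-- The top tree and the bottom trees occupy disjoint intervals. Injectivity is needed for bounding
differences of ranks in a compacted tree. -/
theorem vebIndex_injective {n : ℕ} {ds ds' : List (Fin 3)} (hd : ds.length < n)
    (hd' : ds'.length < n) (heq : vebIndex ε n ds = vebIndex ε n ds') : ds = ds' := by
  induction n using Nat.strong_induction_on generalizing ds ds' with
  | _ n ih =>
    rcases Nat.lt_or_ge 1 n with h | h
    · have ha := topLevels_lt ε h
      have ha' := one_le_topLevels ε n
      set a := topLevels ε n with ha_def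
      have hb : ∀ {es : List (Fin 3)}, es.length < n → (es.drop a).length < n - a := by
        intro es h; rw [List.length_drop]; omega
      rcases Nat.lt_or_ge ds.length a with h1 | h1 <;> rcases Nat.lt_or_ge ds'.length a with h2 | h2
      · rw [vebIndex_of_lt h h1, vebIndex_of_lt h h2] at heq
        exact ih a ha h1 h2 heq
      · rw [vebIndex_of_lt h h1, vebIndex_of_le h h2, ← ha_def] at heq
        have := vebIndex_lt_ternarySize (ε := ε) h1
        omega
      · rw [vebIndex_of_le h h1, vebIndex_of_lt h h2, ← ha_def] at heq
        have := vebIndex_lt_ternarySize (ε := ε) h2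
        omega
      · rw [vebIndex_of_le h h1, vebIndex_of_le h h2, ← ha_def] at heq
        have h3 := vebIndex_lt_ternarySize (ε := ε) (hb hd)
        have h4 := vebIndex_lt_ternarySize (ε := ε) (hb hd')
        have hpos : 0 < ternarySize (n - a) := ternarySize_pos (by omega)
        have h5 : ternaryValue (ds.take a) * ternarySize (n - a) +
            vebIndex ε (n - a) (ds.drop a) =
            ternaryValue (ds'.take a) * ternarySize (n - a) +
            vebIndex ε (n - a) (ds'.drop a) := by omega
        -- Division by the size of one bottom tree separates the number of the bottom tree from the
        -- place inside it.
        have h6 := congrArg (· / ternarySize (n - a)) h5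
        have h7 := congrArg (· % ternarySize (n - a)) h5
        simp only [Nat.mul_add_mod', Nat.mod_eq_of_lt h3, Nat.mod_eq_of_lt h4] at h7
        simp only [mul_comm _ (ternarySize (n - a)), Nat.mul_add_div hpos,
          Nat.div_eq_of_lt h3, Nat.div_eq_of_lt h4, add_zero] at h6
        rw [← List.take_append_drop a ds, ← List.take_append_drop a ds',
          ih (n - a) (by omega) (hb hd) (hb hd') h7,
          ternaryValue_injective (by simp [h1, h2]) h6]
    · rw [List.length_eq_zero_iff.1 (by omega : ds.length = 0),
        List.length_eq_zero_iff.1 (by omega : ds'.length = 0)]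

/-- Both nodes lie in the top tree, or in the same bottom tree, or the edge crosses the cut; in the
last case the top tree is stored first. -/
theorem vebIndex_lt_child {n : ℕ} {ds : List (Fin 3)} {e : Fin 3} (hd : ds.length + 1 < n) :
    vebIndex ε n ds < vebIndex ε n (ds ++ [e]) := by
  induction n using Nat.strong_induction_on generalizing ds with
  | _ n ih =>
    have h : 1 < n := by omega
    have ha := topLevels_lt ε h
    have ha' := one_le_topLevels ε n
    have hl : (ds ++ [e]).length = ds.length + 1 := by simp
    set a := topLevels ε n with ha_def
    rcases Nat.lt_trichotomy (ds.length + 1) a with h1 | h1 | h1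
    · rw [vebIndex_of_lt h (by omega), vebIndex_of_lt h (by omega)]
      exact ih a ha h1
    · rw [vebIndex_of_lt h (by omega), vebIndex_of_le h (by omega), ← ha_def]
      have := vebIndex_lt_ternarySize (ε := ε) (by omega : ds.length < a)
      omega
    · rw [vebIndex_of_le h (by omega), vebIndex_of_le h (by omega), ← ha_def,
        List.take_append_of_le_length (by omega), List.drop_append_of_le_length (by omega)]
      have := ih (n - a) (by omega) (ds := ds.drop a) (by rw [List.length_drop]; omega)
      omega

/-- Needed because the descent may examine a lower child and then the upper one. At the cut,
siblings are roots of different bottom trees, which are stored from left to right. -/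
theorem vebIndex_lt_sibling {n : ℕ} {ds : List (Fin 3)} {e e' : Fin 3} (he : e < e')
    (hd : ds.length + 1 < n) : vebIndex ε n (ds ++ [e]) < vebIndex ε n (ds ++ [e']) := by
  induction n using Nat.strong_induction_on generalizing ds with
  | _ n ih =>
    have h : 1 < n := by omega
    have ha := topLevels_lt ε h
    have ha' := one_le_topLevels ε n
    have hl : (ds ++ [e]).length = ds.length + 1 := by simp
    have hl' : (ds ++ [e']).length = ds.length + 1 := by simp
    set a := topLevels ε n with ha_def
    rcases Nat.lt_trichotomy (ds.length + 1) a with h1 | h1 | h1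
    · rw [vebIndex_of_lt h (by omega), vebIndex_of_lt h (by omega)]
      exact ih a ha h1
    · rw [vebIndex_of_le h (by omega), vebIndex_of_le h (by omega), ← ha_def,
        List.take_of_length_le (by omega), List.take_of_length_le (by omega),
        List.drop_of_length_le (by omega), List.drop_of_length_le (by omega),
        ternaryValue_append_singleton, ternaryValue_append_singleton]
      have hpos : 0 < ternarySize (n - a) := ternarySize_pos (by omega)
      have : 3 * ternaryValue ds + (e : ℕ) < 3 * ternaryValue ds + (e' : ℕ) := by
        have : (e : ℕ) < e' := he
        omega
      have := Nat.mul_lt_mul_of_pos_right this hpos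
      omega
    · rw [vebIndex_of_le h (by omega), vebIndex_of_le h (by omega), ← ha_def,
        List.take_append_of_le_length (by omega), List.drop_append_of_le_length (by omega),
        List.take_append_of_le_length (by omega), List.drop_append_of_le_length (by omega)]
      have := ih (n - a) (by omega) (ds := ds.drop a) (by rw [List.length_drop]; omega)
      omega

/-- The depths at which a tree with `n` levels is cut until all parts have at most `N` levels. -/
noncomputable def cuts (ε : ℝ) (N n : ℕ) : List ℕ :=
  if _h : n ≤ max 1 N then [0]
  else cuts ε N (topLevels ε n) ++ (cuts ε N (n - topLevels ε n)).map (topLevels ε n + ·)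
termination_by n
decreasing_by
  all_goals (unfold topLevels; omega)

/-- The depth of the root of the part to which a node of depth `d` belongs. -/
noncomputable def lastCut (ε : ℝ) (N n d : ℕ) : ℕ :=
  if _h : n ≤ max 1 N then 0
  else if d < topLevels ε n then lastCut ε N (topLevels ε n) d
  else topLevels ε n + lastCut ε N (n - topLevels ε n) (d - topLevels ε n)
termination_by n
decreasing_by
  all_goals (unfold topLevels; omega)

theorem lastCut_mem_cuts (ε : ℝ) (N n d : ℕ) : lastCut ε N n d ∈ cuts ε N n := by
  induction n using Nat.strong_induction_on generalizing d with
  | _ n ih =>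
    rw [lastCut, cuts]
    split_ifs with h h1
    · simp
    · exact List.mem_append_left _ (ih _ (topLevels_lt ε (by omega)) d)
    · have := one_le_topLevels ε n
      exact List.mem_append_right _ (List.mem_map_of_mem (ih _ (by omega) _))

theorem lastCut_le (ε : ℝ) (N n d : ℕ) : lastCut ε N n d ≤ d := by
  induction n using Nat.strong_induction_on generalizing d with
  | _ n ih =>
    rw [lastCut]
    split_ifs with h h1
    · simp
    · exact ih _ (topLevels_lt ε (by omega)) d
    · have := one_le_topLevels ε n
      have := ih (n - topLevels ε n) (by omega) (d - topLevels ε n)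
      omega

/-- The lowest level belongs to the deepest part. Consequently the parts met by a path are
determined by its beginning, down to the root of the lowest part. -/
theorem le_lastCut_of_mem_cuts {N n c : ℕ} (hn : 1 ≤ n) (h : c ∈ cuts ε N n) :
    c ≤ lastCut ε N n (n - 1) := by
  induction n using Nat.strong_induction_on generalizing c with
  | _ n ih =>
    rw [cuts] at h
    rw [lastCut]
    split_ifs at h with h0
    · simp_all
    · have ha' := one_le_topLevels ε n
      have ha := topLevels_lt ε (n := n) (by omega)
      rw [dif_neg h0, if_neg (by omega)]
      rcases List.mem_append.1 h with h | h
      · have h1 := ih _ ha ha' h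
        have h2 := lastCut_le ε N (topLevels ε n) (topLevels ε n - 1)
        omega
      · obtain ⟨c', hc', rfl⟩ := List.mem_map.1 h
        have h1 := ih (n - topLevels ε n) (by omega) (by omega) hc'
        rw [show n - 1 - topLevels ε n = n - topLevels ε n - 1 by omega]
        omega

/-- Each part of the layout is contiguous. -/
theorem vebIndex_take_lastCut {N n : ℕ} (hN : 1 ≤ N) {ds : List (Fin 3)} (hd : ds.length < n) :
    vebIndex ε n (ds.take (lastCut ε N n ds.length)) ≤ vebIndex ε n ds ∧
      vebIndex ε n ds < vebIndex ε n (ds.take (lastCut ε N n ds.length)) + 3 ^ N := by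
  induction n using Nat.strong_induction_on generalizing ds with
  | _ n ih =>
    rw [lastCut]
    split_ifs with h h1
    · rw [List.take_zero, vebIndex_nil, zero_add]
      refine ⟨Nat.zero_le _, (vebIndex_lt_ternarySize hd).trans ((ternarySize_lt_pow n).trans_le ?_)⟩
      exact Nat.pow_le_pow_right (by norm_num) (by omega)
    · have ha := topLevels_lt ε (n := n) (by omega)
      rw [vebIndex_of_lt (by omega) h1, vebIndex_of_lt (by omega)
        ((List.length_take_le' _ _).trans_lt h1)]
      exact ih _ ha h1
    · have ha := topLevels_lt ε (n := n) (by omega)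
      have ha' := one_le_topLevels ε n
      set a := topLevels ε n with ha_def
      have h2 := ih (n - a) (by omega) (ds := ds.drop a) (by rw [List.length_drop]; omega)
      rw [List.length_drop] at h2
      set c := lastCut ε N (n - a) (ds.length - a)
      have hc : c ≤ ds.length - a := lastCut_le ε N (n - a) (ds.length - a)
      rw [vebIndex_of_le (n := n) (ds := ds) (by omega) (by omega),
        vebIndex_of_le (n := n) (ds := ds.take (a + c)) (by omega)
        (by rw [List.length_take]; omega), ← ha_def, List.take_take, List.drop_take,
        min_eq_left (by omega), Nat.add_sub_cancel_left]
      omega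

/-! ### Number and height of the parts -/

theorem mul_le_topLevels (h₀ : 0 < ε) (h₁ : ε < 1) {n : ℕ} (hn : 2 ≤ n) :
    ε / 2 * n ≤ topLevels ε n := by
  have hn' : (2 : ℝ) ≤ n := by exact_mod_cast hn
  have h2 : ε * n < ⌊ε * n⌋₊ + 1 := Nat.lt_floor_add_one _
  have h3 : ε / 2 * n ≤ (n : ℝ) - 1 := by nlinarith
  rcases Nat.eq_zero_or_pos ⌊ε * n⌋₊ with h | h
  · rw [h, Nat.cast_zero] at h2
    have : (1 : ℝ) ≤ topLevels ε n := by exact_mod_cast one_le_topLevels ε n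
    nlinarith
  · have h4 : (1 : ℝ) ≤ ⌊ε * n⌋₊ := by exact_mod_cast h
    have h5 : ε / 2 * n ≤ ((min (n - 1) ⌊ε * n⌋₊ : ℕ) : ℝ) := by
      rw [Nat.cast_min, le_min_iff, Nat.cast_sub (by omega), Nat.cast_one]
      exact ⟨h3, by linarith⟩
    exact h5.trans (by exact_mod_cast le_max_right _ _)

/-- The first bound has the exact factor `1 - ε`, which becomes the exponent `θ`; the second one is
linear without a loss and serves to count the cuts. -/
theorem mul_sub_one_le_sub_topLevels (h₀ : 0 < ε) (h₁ : ε < 1) {n : ℕ} (hn : 2 ≤ n) :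
    (1 - ε) * n - 1 ≤ (n - topLevels ε n : ℕ) ∧
      (1 - ε) / 2 * n ≤ (n - topLevels ε n : ℕ) := by
  have hn' : (2 : ℝ) ≤ n := by exact_mod_cast hn
  have h2 : (⌊ε * n⌋₊ : ℝ) ≤ ε * n := Nat.floor_le (by positivity)
  have h3 : topLevels ε n ≤ max 1 ⌊ε * n⌋₊ := max_le_max le_rfl (min_le_right _ _)
  rw [Nat.cast_sub (topLevels_lt ε (by omega)).le]
  rcases le_max_iff.1 h3 with h | h
  · have : (topLevels ε n : ℝ) ≤ 1 := by exact_mod_cast h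
    constructor <;> nlinarith
  · have : (topLevels ε n : ℝ) ≤ ⌊ε * n⌋₊ := by exact_mod_cast h
    constructor <;> nlinarith

/-- There are few cuts. -/
theorem length_cuts_le (h₀ : 0 < ε) (h₁ : ε < 1) (N n : ℕ) :
    (cuts ε N n).length = 1 ∨
      (cuts ε N n).length * (min ε (1 - ε) / 2 * N) ≤ n := by
  induction n using Nat.strong_induction_on with
  | _ n ih =>
    rw [cuts]
    split_ifs with h
    · left; rfl
    · right
      have ha' := one_le_topLevels ε n
      have ha := topLevels_lt ε (n := n) (by omega)
      have h2 := mul_le_topLevels h₀ h₁ (n := n) (by omega)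
      have h3 := (mul_sub_one_le_sub_topLevels h₀ h₁ (n := n) (by omega)).2
      have hnN : (N : ℝ) ≤ n := by exact_mod_cast (by omega : N ≤ n)
      have hn0 : (0 : ℝ) ≤ N := Nat.cast_nonneg N
      set δ := min ε (1 - ε) / 2 with hδ
      have hδ0 : 0 < δ := by
        have := lt_min h₀ (sub_pos.2 h₁)
        positivity
      have hδ1 : δ ≤ ε / 2 := by have := min_le_left ε (1 - ε); rw [hδ]; linarith
      have hδ2 : δ ≤ (1 - ε) / 2 := by have := min_le_right ε (1 - ε); rw [hδ]; linarith
      -- A piece that consists of one part satisfies the linear bound as well: the tree just cut had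
      -- more than `N` levels, and the piece got at least the fraction `δ` of them.
      have h4 : ((cuts ε N (topLevels ε n)).length : ℝ) * (δ * N) ≤ topLevels ε n := by
        rcases ih _ ha with h5 | h5
        · rw [h5, Nat.cast_one, one_mul]
          refine le_trans ?_ h2
          gcongr
        · exact h5
      have h5 : ((cuts ε N (n - topLevels ε n)).length : ℝ) * (δ * N) ≤
          (n - topLevels ε n : ℕ) := by
        rcases ih (n - topLevels ε n) (by omega) with h6 | h6
        · rw [h6, Nat.cast_one, one_mul]
          refine le_trans ?_ h3
          gcongr
        · exact h6
      rw [List.length_append, List.length_map, Nat.cast_add, add_mul]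
      rw [Nat.cast_sub ha.le] at h5
      linarith

/-- The parts at the bottom have many levels. -/
theorem levels_sub_lastCut (h₀ : 0 < ε) (h₁ : ε < 1) {N n : ℕ} (hN : 1 ≤ N) (hn : 1 ≤ n) :
    lastCut ε N n (n - 1) = 0 ∨
      (1 - ε) * (N + 1) - 1 ≤ ((n - lastCut ε N n (n - 1) : ℕ) : ℝ) := by
  induction n using Nat.strong_induction_on with
  | _ n ih =>
    rw [lastCut]
    split_ifs with h h1
    · left; rfl
    · have := topLevels_lt ε (n := n) (by omega)
      omega
    · right
      have ha' := one_le_topLevels ε n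
      have ha := topLevels_lt ε (n := n) (by omega)
      rw [show n - 1 - topLevels ε n = n - topLevels ε n - 1 by omega, ← Nat.sub_sub]
      -- If the lower piece is not cut any further, it comes from a tree with at least `N + 1`
      -- levels.
      rcases ih (n - topLevels ε n) (by omega) (by omega) with h2 | h2
      · rw [h2, Nat.sub_zero]
        refine le_trans ?_ (mul_sub_one_le_sub_topLevels h₀ h₁ (n := n) (by omega)).1
        have : ((N : ℝ) + 1) ≤ n := by exact_mod_cast (by omega : N + 1 ≤ n)
        have : 0 < 1 - ε := by linarith
        gcongr
      · exact h2

/-- The roots of the parts visited on the way from the root to the leaf `ℓ`, and their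
siblings. -/
noncomputable def partRoots (ε : ℝ) (N n : ℕ) (ℓ : List (Fin 3)) : Finset (List (Fin 3)) :=
  (cuts ε N n).toFinset.biUnion fun c =>
    -- For `c = 0` the truncated subtraction adds the children of the root, which does no harm.
    insert (ℓ.take c) (Finset.univ.image fun e : Fin 3 => ℓ.take (c - 1) ++ [e])

theorem card_partRoots_le (ε : ℝ) (N n : ℕ) (ℓ : List (Fin 3)) :
    (partRoots ε N n ℓ).card ≤ (cuts ε N n).length * 4 := by
  refine (Finset.card_biUnion_le_card_mul _ _ 4 fun c _ => ?_).trans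
    (Nat.mul_le_mul_right _ (List.toFinset_card_le _))
  refine (Finset.card_insert_le _ _).trans (Nat.succ_le_succ ?_)
  exact Finset.card_image_le

/-- No cut is deeper than the one above the lowest part, so what happens inside the lowest part does
not matter. This is why neighbouring columns share their blocks. -/
theorem partRoots_congr {N n : ℕ} (hn : 1 ≤ n) {ℓ ℓ' : List (Fin 3)}
    (h : ℓ.take (lastCut ε N n (n - 1)) = ℓ'.take (lastCut ε N n (n - 1))) :
    partRoots ε N n ℓ = partRoots ε N n ℓ' := by
  have key : ∀ k ≤ lastCut ε N n (n - 1), ℓ.take k = ℓ'.take k := by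
    intro k hk
    rw [← min_eq_left hk, ← List.take_take, h, List.take_take]
  refine Finset.biUnion_congr rfl fun c hc => ?_
  have hc' := le_lastCut_of_mem_cuts hn (List.mem_toFinset.1 hc)
  rw [key c hc', key (c - 1) (by omega)]

theorem take_lastCut_mem_partRoots (N n : ℕ) (ℓ : List (Fin 3)) (k : ℕ) (hk : k ≤ ℓ.length) :
    (ℓ.take k).take (lastCut ε N n (ℓ.take k).length) ∈ partRoots ε N n ℓ := by
  rw [List.length_take_of_le hk]
  refine Finset.mem_biUnion.2 ⟨lastCut ε N n k, List.mem_toFinset.2 (lastCut_mem_cuts _ _ _ _), ?_⟩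
  rw [List.take_take, min_eq_left (lastCut_le _ _ _ _)]
  exact Finset.mem_insert_self _ _

theorem take_append_lastCut_mem_partRoots (N n : ℕ) (ℓ : List (Fin 3)) (k : ℕ)
    (hk : k ≤ ℓ.length) (e : Fin 3) :
    (ℓ.take k ++ [e]).take (lastCut ε N n (ℓ.take k ++ [e]).length) ∈ partRoots ε N n ℓ := by
  rw [List.length_append, List.length_take_of_le hk, List.length_singleton]
  refine Finset.mem_biUnion.2
    ⟨lastCut ε N n (k + 1), List.mem_toFinset.2 (lastCut_mem_cuts _ _ _ _), ?_⟩
  have h := lastCut_le ε N n (k + 1)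
  set c := lastCut ε N n (k + 1)
  -- Either the child is itself the root of a part, and then it is listed as a sibling, or the root
  -- of its part lies on the path.
  rcases Nat.lt_or_ge k c with h1 | h1
  · rw [show c = k + 1 by omega]
    rw [List.take_of_length_le (l := ℓ.take k ++ [e]) (by simp)]
    exact Finset.mem_insert_of_mem (Finset.mem_image.2 ⟨e, Finset.mem_univ e, rfl⟩)
  · rw [List.take_append_of_le_length (by rw [List.length_take_of_le hk]; exact h1),
      List.take_take, min_eq_left h1]
    exact Finset.mem_insert_self _ _

end COPersistence

namespace COPersistence

namespace STTree

variable {α : Type*}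

/-! ### Rectangles of space-time trees -/

/-- A space-time tree of height `h` whose third children begin after versions up to `T`: the
rectangle of each node is partitioned by the rectangles of its children. -/
inductive IsSTTree (T : ℕ) : ℕ → STTree α → Prop
  | leaf (r : Rect) (point : Option (ℕ × α)) (val : α) (hr : r.width = 1) :
      IsSTTree T 0 (leaf r point val)
  | node2 (h : ℕ) (r : Rect) (l m : STTree α) (hr : r.width = 2 ^ (h + 1))
      (hl : IsSTTree T h l) (hm : IsSTTree T h m)
      (rl : l.rect = ⟨r.left, 2 ^ h, r.bot, r.top⟩)
      (rm : m.rect = ⟨r.left + 2 ^ h, 2 ^ h, r.bot, r.top⟩) : IsSTTree T (h + 1) (node2 r l m)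
  | upperLeft (h : ℕ) (r : Rect) (l m u : STTree α) (t : ℕ) (hr : r.width = 2 ^ (h + 1))
      (hT : t ≤ T) (hb : r.bot ≤ t + 1) (ht : ∀ w ∈ r.top, t ≤ w)
      (hl : IsSTTree T h l) (hm : IsSTTree T h m) (hu : IsSTTree T h u)
      (rl : l.rect = ⟨r.left, 2 ^ h, r.bot, some t⟩)
      (rm : m.rect = ⟨r.left + 2 ^ h, 2 ^ h, r.bot, r.top⟩)
      (ru : u.rect = ⟨r.left, 2 ^ h, t + 1, r.top⟩) : IsSTTree T (h + 1) (node3 r l m u)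
  | upperRight (h : ℕ) (r : Rect) (l m u : STTree α) (t : ℕ) (hr : r.width = 2 ^ (h + 1))
      (hT : t ≤ T) (hb : r.bot ≤ t + 1) (ht : ∀ w ∈ r.top, t ≤ w)
      (hl : IsSTTree T h l) (hm : IsSTTree T h m) (hu : IsSTTree T h u)
      (rl : l.rect = ⟨r.left, 2 ^ h, r.bot, r.top⟩)
      (rm : m.rect = ⟨r.left + 2 ^ h, 2 ^ h, r.bot, some t⟩)
      (ru : u.rect = ⟨r.left + 2 ^ h, 2 ^ h, t + 1, r.top⟩) : IsSTTree T (h + 1) (node3 r l m u)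

theorem IsSTTree.mono {T T' h : ℕ} {t : STTree α} (H : IsSTTree T h t) (hT : T ≤ T') :
    IsSTTree T' h t := by
  induction H with
  | leaf r point val hr => exact .leaf _ _ _ hr
  | node2 h r l m hr hl hm rl rm ihl ihm => exact .node2 _ _ _ _ hr ihl ihm rl rm
  | upperLeft h r l m u t hr hT' hb ht hl hm hu rl rm ru ihl ihm ihu =>
    exact .upperLeft _ _ _ _ _ t hr (hT'.trans hT) hb ht ihl ihm ihu rl rm ru
  | upperRight h r l m u t hr hT' hb ht hl hm hu rl rm ru ihl ihm ihu =>
    exact .upperRight _ _ _ _ _ t hr (hT'.trans hT) hb ht ihl ihm ihu rl rm ru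

theorem IsSTTree.height {T h : ℕ} {t : STTree α} (H : IsSTTree T h t) : t.height = h := by
  induction H <;> simp_all [STTree.height]

theorem rect_complete (C : ℕ → α) (bot h left : ℕ) :
    (complete C bot h left).rect = ⟨left, 2 ^ h, bot, none⟩ := by
  cases h <;> simp [complete, rect]

theorem isSTTree_complete (T : ℕ) (C : ℕ → α) (bot h left : ℕ) :
    IsSTTree T h (complete C bot h left) := by
  induction h generalizing left with
  | zero => exact .leaf _ _ _ rfl
  | succ h ih =>
    exact .node2 _ _ _ _ rfl (ih _) (ih _) (rect_complete _ _ _ _) (rect_complete _ _ _ _)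

theorem rect_close (v : ℕ) (t : STTree α) : (t.close v).rect = t.rect.close v := by
  cases t <;> rfl

theorem IsSTTree.close {T h v : ℕ} {t : STTree α} (H : IsSTTree T h t) (hv : T ≤ v) :
    IsSTTree T h (t.close v) := by
  -- The version at which the third child was put on top stays below the new top side; this is the
  -- purpose of the bound `T`.
  have key : ∀ {r : Rect} {t : ℕ}, (∀ w ∈ r.top, t ≤ w) → t ≤ T → ∀ w ∈ (r.close v).top, t ≤ w := by
    intro r t h hT w hw
    cases hr : r.top with
    | none => simp [Rect.close, hr] at hw; omega
    | some w' => simp [Rect.close, hr] at hw; exact h w (by simp [hr, hw])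
  induction H with
  | leaf r point val hr => exact .leaf _ _ _ hr
  | node2 h r l m hr hl hm rl rm ihl ihm =>
    exact .node2 _ _ _ _ hr ihl ihm (by rw [rect_close, rl]; rfl) (by rw [rect_close, rm]; rfl)
  | upperLeft h r l m u t hr hT hb ht hl hm hu rl rm ru ihl ihm ihu =>
    exact .upperLeft _ _ _ _ _ t hr hT hb (key ht hT) ihl ihm ihu (by rw [rect_close, rl]; rfl)
      (by rw [rect_close, rm]; rfl) (by rw [rect_close, ru]; rfl)
  | upperRight h r l m u t hr hT hb ht hl hm hu rl rm ru ihl ihm ihu =>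
    exact .upperRight _ _ _ _ _ t hr hT hb (key ht hT) ihl ihm ihu (by rw [rect_close, rl]; rfl)
      (by rw [rect_close, rm]; rfl) (by rw [rect_close, ru]; rfl)

theorem rect_insert (C : ℕ → α) (v i : ℕ) (x : α) (t : STTree α) :
    (t.insert C v i x).rect = t.rect := by
  cases t <;> simp only [insert] <;> (try split_ifs) <;> rfl

/-- Only open subtrees receive the point: of three children, the one below the third is closed, so
the test on `top` finds the open one. A child that becomes full is closed at `v` and continued from
`v + 1`, which again partitions the rectangle. -/
theorem IsSTTree.insert {T h v : ℕ} {t : STTree α} (H : IsSTTree T h t)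
    (htop : t.rect.top = none) (hv : T ≤ v) (hbot : t.rect.bot ≤ v + 1) (C : ℕ → α) (i : ℕ)
    (x : α) : IsSTTree v h (t.insert C v i x) := by
  induction H with
  | leaf r point val hr => exact .leaf _ _ _ hr
  | node2 h r l m hr hl hm rl rm ihl ihm =>
    replace htop : r.top = none := htop
    have hbot' : r.bot ≤ v + 1 := hbot
    have hl' := ihl (by rw [rl]; exact htop) (by rw [rl]; exact hbot)
    have hm' := ihm (by rw [rm]; exact htop) (by rw [rm]; exact hbot)
    simp only [STTree.insert, hl.height, hm.height, rl, rm]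
    split_ifs
    · exact .upperLeft _ _ _ _ _ v hr le_rfl hbot' (by simp [htop]) (hl'.close le_rfl)
        (hm.mono hv) (isSTTree_complete _ _ _ _ _)
        (by rw [rect_close, rect_insert, rl, htop]; rfl) rm (by rw [rect_complete, htop])
    · exact .node2 _ _ _ _ hr hl' (hm.mono hv) (by rw [rect_insert, rl]) rm
    · exact .upperRight _ _ _ _ _ v hr le_rfl hbot' (by simp [htop]) (hl.mono hv)
        (hm'.close le_rfl) (isSTTree_complete _ _ _ _ _) rl
        (by rw [rect_close, rect_insert, rm, htop]; rfl) (by rw [rect_complete, htop])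
    · exact .node2 _ _ _ _ hr (hl.mono hv) hm' rl (by rw [rect_insert, rm])
  | upperLeft h r l m u t hr hT hb ht hl hm hu rl rm ru ihl ihm ihu =>
    have hm' := ihm (by rw [rm]; exact htop) (by rw [rm]; exact hbot)
    have hu' := ihu (by rw [ru]; exact htop) (by rw [ru]; exact Nat.succ_le_succ (hT.trans hv))
    have hT' := hT.trans hv
    simp only [STTree.insert]
    split_ifs with h1 h2 h2
    · simp [rl] at h2
    · exact .upperLeft _ _ _ _ _ t hr hT' hb ht (hl.mono hv) (hm.mono hv) hu' rl rm
        (by rw [rect_insert, ru])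
    · exact .upperLeft _ _ _ _ _ t hr hT' hb ht (hl.mono hv) hm' (hu.mono hv) rl
        (by rw [rect_insert, rm]) ru
    · exact .upperLeft _ _ _ _ _ t hr hT' hb ht (hl.mono hv) (hm.mono hv) hu' rl rm
        (by rw [rect_insert, ru])
  | upperRight h r l m u t hr hT hb ht hl hm hu rl rm ru ihl ihm ihu =>
    have hl' := ihl (by rw [rl]; exact htop) (by rw [rl]; exact hbot)
    have hu' := ihu (by rw [ru]; exact htop) (by rw [ru]; exact Nat.succ_le_succ (hT.trans hv))
    have hT' := hT.trans hv
    simp only [STTree.insert]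
    split_ifs with h1 h2 h2
    · exact .upperRight _ _ _ _ _ t hr hT' hb ht hl' (hm.mono hv) (hu.mono hv)
        (by rw [rect_insert, rl]) rm ru
    · exact .upperRight _ _ _ _ _ t hr hT' hb ht (hl.mono hv) (hm.mono hv) hu' rl rm
        (by rw [rect_insert, ru])
    · simp [rm] at h2
    · exact .upperRight _ _ _ _ _ t hr hT' hb ht (hl.mono hv) (hm.mono hv) hu' rl rm
        (by rw [rect_insert, ru])

/-! ### Moving in a tree -/

theorem _root_.COPersistence.Rect.contains_iff {r : Rect} {a w b : ℕ} {top : Option ℕ}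
    (h : r = ⟨a, w, b, top⟩) (i v : ℕ) :
    r.Contains i v ↔ a ≤ i ∧ i < a + w ∧ b ≤ v ∧ ∀ t ∈ top, v ≤ t := by
  rw [h]; rfl

theorem _root_.COPersistence.Rect.inLeftHalf_iff {r : Rect} {h : ℕ} (hr : r.width = 2 ^ (h + 1))
    (i : ℕ) : r.InLeftHalf i ↔ i < r.left + 2 ^ h := by
  rw [Rect.InLeftHalf, hr, pow_succ, Nat.mul_div_cancel _ (Nat.succ_pos 1)]

theorem rect_node2 (r : Rect) (l m : STTree α) : (STTree.node2 r l m).rect = r := rfl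

theorem rect_node3 (r : Rect) (l m u : STTree α) : (STTree.node3 r l m u).rect = r := rfl

/-- The leaf found by moving down does not depend on the node at which one starts. -/
theorem IsSTTree.descend_follow {T h : ℕ} {t : STTree α} (H : IsSTTree T h t) {i v : ℕ}
    {ds : List (Fin 3)} {s : STTree α} (hs : t.follow ds = some s) (hc : s.rect.Contains i v)
    (q : Pos) : t.rect.Contains i v ∧
      (t.descend i v q).2 = (s.descend i v (ds.reverse ++ q)).2 := by
  induction H generalizing ds q with
  | leaf r point val hr =>
    cases ds with
    | nil => obtain rfl : _ = s := by simpa [follow] using hs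
             exact ⟨hc, rfl⟩
    | cons d ds => simp [follow] at hs
  | node2 h r l m hr hl hm rl rm ihl ihm =>
    cases ds with
    | nil => obtain rfl : _ = s := by simpa [follow] using hs
             exact ⟨hc, rfl⟩
    | cons d ds =>
      rw [List.reverse_cons, List.append_assoc, List.singleton_append]
      have cl := Rect.contains_iff rl i v
      have cm := Rect.contains_iff rm i v
      simp only [follow] at hs
      simp only [rect_node2, descend, Rect.inLeftHalf_iff hr]
      rw [Rect.contains_iff (r := r) rfl i v, hr, pow_succ]
      split_ifs at hs with h0 h1
      · obtain ⟨h2, h3⟩ := ihl hs (0 :: q)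
        have h4 := cl.1 h2
        rw [if_pos (by omega), h0]
        exact ⟨⟨by omega, by omega, h4.2.2⟩, h3⟩
      · obtain ⟨h2, h3⟩ := ihm hs (1 :: q)
        have h4 := cm.1 h2
        rw [if_neg (by omega), h1]
        exact ⟨⟨by omega, by omega, h4.2.2⟩, h3⟩
  | upperLeft h r l m u t hr hT hb ht hl hm hu rl rm ru ihl ihm ihu =>
    cases ds with
    | nil => obtain rfl : _ = s := by simpa [follow] using hs
             exact ⟨hc, rfl⟩
    | cons d ds =>
      rw [List.reverse_cons, List.append_assoc, List.singleton_append]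
      have cl := Rect.contains_iff rl i v
      have cm := Rect.contains_iff rm i v
      have cu := Rect.contains_iff ru i v
      simp only [Option.mem_some_iff, forall_eq'] at cl cm cu
      simp only [follow] at hs
      simp only [rect_node3, descend, Rect.inLeftHalf_iff hr]
      rw [Rect.contains_iff (r := r) rfl i v, hr, pow_succ]
      split_ifs at hs with h0 h1
      · obtain ⟨h2, h3⟩ := ihl hs (0 :: q)
        have h4 := cl.1 h2
        rw [if_pos (by omega), if_pos h2, h0]
        exact ⟨⟨by omega, by omega, by omega, fun w hw => by have := ht w hw; omega⟩, h3⟩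
      · obtain ⟨h2, h3⟩ := ihm hs (1 :: q)
        have h4 := cm.1 h2
        rw [if_neg (by omega), if_pos h2, h1]
        exact ⟨⟨by omega, by omega, h4.2.2⟩, h3⟩
      · obtain ⟨h2, h3⟩ := ihu hs (2 :: q)
        have h4 := cu.1 h2
        rw [if_pos (by omega), if_neg (fun h => by have := cl.1 h; omega), (by omega : d = 2)]
        exact ⟨⟨by omega, by omega, by omega, h4.2.2.2⟩, h3⟩
  | upperRight h r l m u t hr hT hb ht hl hm hu rl rm ru ihl ihm ihu =>
    cases ds with
    | nil => obtain rfl : _ = s := by simpa [follow] using hs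
             exact ⟨hc, rfl⟩
    | cons d ds =>
      rw [List.reverse_cons, List.append_assoc, List.singleton_append]
      have cl := Rect.contains_iff rl i v
      have cm := Rect.contains_iff rm i v
      have cu := Rect.contains_iff ru i v
      simp only [Option.mem_some_iff, forall_eq'] at cl cm cu
      simp only [follow] at hs
      simp only [rect_node3, descend, Rect.inLeftHalf_iff hr]
      rw [Rect.contains_iff (r := r) rfl i v, hr, pow_succ]
      split_ifs at hs with h0 h1
      · obtain ⟨h2, h3⟩ := ihl hs (0 :: q)
        have h4 := cl.1 h2
        rw [if_pos (by omega), if_pos h2, h0]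
        exact ⟨⟨by omega, by omega, h4.2.2⟩, h3⟩
      · obtain ⟨h2, h3⟩ := ihm hs (1 :: q)
        have h4 := cm.1 h2
        rw [if_neg (by omega), if_pos h2, h1]
        exact ⟨⟨by omega, by omega, by omega, fun w hw => by have := ht w hw; omega⟩, h3⟩
      · obtain ⟨h2, h3⟩ := ihu hs (2 :: q)
        have h4 := cu.1 h2
        rw [if_neg (by omega), if_neg (fun h => by have := cm.1 h; omega), (by omega : d = 2)]
        exact ⟨⟨by omega, by omega, by omega, h4.2.2.2⟩, h3⟩

/-- The directions from the root to the leaf which contains `(i, v)`. -/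
def leafDirs (i v : ℕ) (t : STTree α) : List (Fin 3) := (t.descend i v []).2.reverse

theorem descend_snd_eq_append (i v : ℕ) (t : STTree α) (q : Pos) :
    (t.descend i v q).2 = (t.descend i v []).2 ++ q := by
  induction t generalizing q with
  | leaf => rfl
  | node2 r l m ihl ihm =>
    simp only [descend]
    split_ifs
    · simp only; rw [ihl, ihl [0]]; simp
    · simp only; rw [ihm, ihm [1]]; simp
  | node3 r l m u ihl ihm ihu =>
    simp only [descend]
    split_ifs
    · simp only; rw [ihl, ihl [0]]; simp
    · simp only; rw [ihu, ihu [2]]; simp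
    · simp only; rw [ihm, ihm [1]]; simp
    · simp only; rw [ihu, ihu [2]]; simp

theorem reverse_descend_snd (i v : ℕ) (t : STTree α) (e : Fin 3) :
    (t.descend i v [e]).2.reverse = e :: leafDirs i v t := by
  rw [descend_snd_eq_append]; simp [leafDirs]

theorem follow_append (t : STTree α) (xs ys : List (Fin 3)) :
    t.follow (xs ++ ys) = (t.follow xs).bind fun s => s.follow ys := by
  induction t generalizing xs with
  | leaf => cases xs <;> simp [follow]
  | node2 r l m ihl ihm =>
    cases xs with
    | nil => simp [follow]
    | cons d xs =>
      simp only [List.cons_append, follow]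
      split_ifs <;> simp [ihl, ihm]
  | node3 r l m u ihl ihm ihu =>
    cases xs with
    | nil => simp [follow]
    | cons d xs =>
      simp only [List.cons_append, follow]
      split_ifs <;> simp [ihl, ihm, ihu]

/-- Columns which agree up to their last `g` binary digits have the same way from the root down to
the node of height `g`. -/
theorem IsSTTree.take_leafDirs_eq {T h : ℕ} {t : STTree α} (H : IsSTTree T h t) {i i' v g : ℕ}
    (hi : t.rect.Contains i v) (hi' : t.rect.Contains i' v) (hd : 2 ^ h ∣ t.rect.left)
    (hg : i / 2 ^ g = i' / 2 ^ g) :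
    (leafDirs i v t).take (h - g) = (leafDirs i' v t).take (h - g) := by
  -- The middle line `a + 2 ^ h` is a multiple of `2 ^ g`, so it does not separate columns with the
  -- same quotient by `2 ^ g`. The version is common to both, so the choice of the upper child
  -- agrees too.
  have half : ∀ {h a : ℕ}, ¬ h + 1 ≤ g → 2 ^ (h + 1) ∣ a → (i < a + 2 ^ h ↔ i' < a + 2 ^ h) := by
    intro h a hgh ha
    have h1 : 2 ^ g ∣ a + 2 ^ h :=
      dvd_add ((pow_dvd_pow 2 (by omega)).trans ha) (pow_dvd_pow 2 (by omega))
    obtain ⟨k, hk⟩ := h1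
    rw [hk, mul_comm, ← Nat.div_lt_iff_lt_mul (by positivity), hg,
      Nat.div_lt_iff_lt_mul (by positivity)]
  induction H with
  | leaf => rfl
  | node2 h r l m hr hl hm rl rm ihl ihm =>
    rcases Nat.lt_or_ge g (h + 1) with hgh | hgh
    · rw [rect_node2] at hi hi' hd
      rw [leafDirs, leafDirs]
      have hd' : 2 ^ h ∣ r.left := (pow_dvd_pow 2 (Nat.le_succ h)).trans hd
      have hh := half (by omega) hd
      rw [Rect.contains_iff (r := r) rfl, hr, pow_succ] at hi hi'
      simp only [descend, Rect.inLeftHalf_iff hr, Nat.succ_sub (Nat.lt_succ_iff.1 hgh)]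
      by_cases hil : i < r.left + 2 ^ h
      · have hil' := hh.1 hil
        simp only [if_pos hil, if_pos hil', reverse_descend_snd, List.take_succ_cons]
        rw [ihl ((Rect.contains_iff rl _ _).2 ⟨by omega, by omega, hi.2.2⟩)
          ((Rect.contains_iff rl _ _).2 ⟨by omega, by omega, hi.2.2⟩) (by simpa only [rl])]
      · have hil' := hh.not.1 hil
        simp only [if_neg hil, if_neg hil', reverse_descend_snd, List.take_succ_cons]
        rw [ihm ((Rect.contains_iff rm _ _).2 ⟨by omega, by omega, hi.2.2⟩)
          ((Rect.contains_iff rm _ _).2 ⟨by omega, by omega, hi.2.2⟩)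
          (by simpa only [rm] using dvd_add hd' dvd_rfl)]
    · simp [Nat.sub_eq_zero_of_le hgh]
  | upperLeft h r l m u t hr hT hb ht hl hm hu rl rm ru ihl ihm ihu =>
    rcases Nat.lt_or_ge g (h + 1) with hgh | hgh
    · rw [rect_node3] at hi hi' hd
      rw [leafDirs, leafDirs]
      have hd' : 2 ^ h ∣ r.left := (pow_dvd_pow 2 (Nat.le_succ h)).trans hd
      have hh := half (by omega) hd
      rw [Rect.contains_iff (r := r) rfl, hr, pow_succ] at hi hi'
      obtain ⟨hi1, hi2, hv1, hv2⟩ := hi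
      obtain ⟨hi1', hi2', -, -⟩ := hi'
      simp only [descend, Rect.inLeftHalf_iff hr, Nat.succ_sub (Nat.lt_succ_iff.1 hgh)]
      have cl := Rect.contains_iff rl
      have cm := Rect.contains_iff rm
      have cu := Rect.contains_iff ru
      simp only [Option.mem_some_iff, forall_eq'] at cl cm cu
      by_cases hil : i < r.left + 2 ^ h
      · have hil' := hh.1 hil
        by_cases hvt : v ≤ t
        · have h1 := (cl i v).2 ⟨by omega, by omega, hv1, hvt⟩
          have h2 := (cl i' v).2 ⟨by omega, by omega, hv1, hvt⟩
          simp only [if_pos hil, if_pos hil', if_pos h1, if_pos h2, reverse_descend_snd, List.take_succ_cons]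
          rw [ihl h1 h2 (by simpa only [rl] using hd')]
        · have h1 := (cu i v).2 ⟨by omega, by omega, by omega, hv2⟩
          have h2 := (cu i' v).2 ⟨by omega, by omega, by omega, hv2⟩
          have h3 : ¬ l.rect.Contains i v := fun h => hvt ((cl i v).1 h).2.2.2
          have h4 : ¬ l.rect.Contains i' v := fun h => hvt ((cl i' v).1 h).2.2.2
          simp only [if_pos hil, if_pos hil', if_neg h3, if_neg h4, reverse_descend_snd, List.take_succ_cons]
          rw [ihu h1 h2 (by simpa only [ru] using hd')]
      · have hil' := hh.not.1 hil
        have h1 := (cm i v).2 ⟨by omega, by omega, hv1, hv2⟩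
        have h2 := (cm i' v).2 ⟨by omega, by omega, hv1, hv2⟩
        simp only [if_neg hil, if_neg hil', if_pos h1, if_pos h2, reverse_descend_snd, List.take_succ_cons]
        rw [ihm h1 h2 (by simpa only [rm] using dvd_add hd' dvd_rfl)]
    · simp [Nat.sub_eq_zero_of_le hgh]
  | upperRight h r l m u t hr hT hb ht hl hm hu rl rm ru ihl ihm ihu =>
    rcases Nat.lt_or_ge g (h + 1) with hgh | hgh
    · rw [rect_node3] at hi hi' hd
      rw [leafDirs, leafDirs]
      have hd' : 2 ^ h ∣ r.left := (pow_dvd_pow 2 (Nat.le_succ h)).trans hd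
      have hh := half (by omega) hd
      rw [Rect.contains_iff (r := r) rfl, hr, pow_succ] at hi hi'
      obtain ⟨hi1, hi2, hv1, hv2⟩ := hi
      obtain ⟨hi1', hi2', -, -⟩ := hi'
      simp only [descend, Rect.inLeftHalf_iff hr, Nat.succ_sub (Nat.lt_succ_iff.1 hgh)]
      have cl := Rect.contains_iff rl
      have cm := Rect.contains_iff rm
      have cu := Rect.contains_iff ru
      simp only [Option.mem_some_iff, forall_eq'] at cl cm cu
      by_cases hil : i < r.left + 2 ^ h
      · have hil' := hh.1 hil
        have h1 := (cl i v).2 ⟨by omega, by omega, hv1, hv2⟩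
        have h2 := (cl i' v).2 ⟨by omega, by omega, hv1, hv2⟩
        simp only [if_pos hil, if_pos hil', if_pos h1, if_pos h2, reverse_descend_snd, List.take_succ_cons]
        rw [ihl h1 h2 (by simpa only [rl] using hd')]
      · have hil' := hh.not.1 hil
        by_cases hvt : v ≤ t
        · have h1 := (cm i v).2 ⟨by omega, by omega, hv1, hvt⟩
          have h2 := (cm i' v).2 ⟨by omega, by omega, hv1, hvt⟩
          simp only [if_neg hil, if_neg hil', if_pos h1, if_pos h2, reverse_descend_snd, List.take_succ_cons]
          rw [ihm h1 h2 (by simpa only [rm] using dvd_add hd' dvd_rfl)]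
        · have h1 := (cu i v).2 ⟨by omega, by omega, by omega, hv2⟩
          have h2 := (cu i' v).2 ⟨by omega, by omega, by omega, hv2⟩
          have h3 : ¬ m.rect.Contains i v := fun h => hvt ((cm i v).1 h).2.2.2
          have h4 : ¬ m.rect.Contains i' v := fun h => hvt ((cm i' v).1 h).2.2.2
          simp only [if_neg hil, if_neg hil', if_neg h3, if_neg h4, reverse_descend_snd, List.take_succ_cons]
          rw [ihu h1 h2 (by simpa only [ru] using dvd_add hd' dvd_rfl)]
    · simp [Nat.sub_eq_zero_of_le hgh]

/-! ### The nodes of a tree -/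

theorem mem_nodesFrom_of_follow {t : STTree α} {ds : List (Fin 3)} (q : Pos)
    (h : (t.follow ds).isSome) : ds.reverse ++ q ∈ t.nodesFrom q := by
  induction t generalizing ds q with
  | leaf =>
    cases ds with
    | nil => simp [nodesFrom]
    | cons d ds => simp [follow] at h
  | node2 r l m ihl ihm =>
    cases ds with
    | nil => simp [nodesFrom]
    | cons d ds =>
      rw [List.reverse_cons, List.append_assoc, List.singleton_append]
      simp only [follow] at h
      simp only [nodesFrom, List.mem_cons, List.mem_append]
      split_ifs at h with h0 h1
      · rw [h0]; exact .inr (.inl (ihl _ h))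
      · rw [h1]; exact .inr (.inr (ihm _ h))
      · simp at h
  | node3 r l m u ihl ihm ihu =>
    cases ds with
    | nil => simp [nodesFrom]
    | cons d ds =>
      rw [List.reverse_cons, List.append_assoc, List.singleton_append]
      simp only [follow] at h
      simp only [nodesFrom, List.mem_cons, List.mem_append]
      split_ifs at h with h0 h1
      · rw [h0]; exact .inr (.inl (.inl (ihl _ h)))
      · rw [h1]; exact .inr (.inl (.inr (ihm _ h)))
      · rw [(by omega : d = 2)]; exact .inr (.inr (ihu _ h))

theorem mem_nodes_of_at {t : STTree α} {q : Pos} (h : (t.at? q).isSome) : q ∈ t.nodes := by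
  have := mem_nodesFrom_of_follow [] h
  rwa [List.reverse_reverse, List.append_nil] at this

theorem suffix_of_mem_nodesFrom {t : STTree α} {q y : Pos} (h : y ∈ t.nodesFrom q) : q <:+ y := by
  induction t generalizing q with
  | leaf => simp only [nodesFrom, List.mem_singleton] at h; rw [h]
  | node2 r l m ihl ihm =>
    simp only [nodesFrom, List.mem_cons, List.mem_append] at h
    rcases h with rfl | h | h
    · exact List.suffix_rfl
    · exact (List.suffix_cons _ _).trans (ihl h)
    · exact (List.suffix_cons _ _).trans (ihm h)
  | node3 r l m u ihl ihm ihu =>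
    simp only [nodesFrom, List.mem_cons, List.mem_append] at h
    rcases h with rfl | (h | h) | h
    · exact List.suffix_rfl
    · exact (List.suffix_cons _ _).trans (ihl h)
    · exact (List.suffix_cons _ _).trans (ihm h)
    · exact (List.suffix_cons _ _).trans (ihu h)

theorem nodup_nodesFrom (t : STTree α) (q : Pos) : (t.nodesFrom q).Nodup := by
  have self : ∀ (s : STTree α) (q : Pos) (e : Fin 3), q ∉ s.nodesFrom (e :: q) := by
    intro s q e h
    have := (suffix_of_mem_nodesFrom h).length_le
    simp at this
  have ne : ∀ (s s' : STTree α) (q : Pos) (e e' : Fin 3), e ≠ e' →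
      (s.nodesFrom (e :: q)).Disjoint (s'.nodesFrom (e' :: q)) := by
    intro s s' q e e' hne y hy hy'
    have := List.suffix_of_suffix_length_le (suffix_of_mem_nodesFrom hy)
      (suffix_of_mem_nodesFrom hy') (by simp)
    have := this.eq_of_length (by simp)
    simp only [List.cons.injEq] at this
    exact hne this.1
  induction t generalizing q with
  | leaf => simp [nodesFrom]
  | node2 r l m ihl ihm =>
    rw [nodesFrom, List.nodup_cons, List.mem_append, List.nodup_append']
    exact ⟨fun h => h.elim (self _ _ _) (self _ _ _), ihl _, ihm _, ne _ _ _ _ _ (by decide)⟩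
  | node3 r l m u ihl ihm ihu =>
    rw [nodesFrom, List.nodup_cons, List.mem_append, List.mem_append, List.nodup_append',
      List.nodup_append', List.disjoint_append_left]
    exact ⟨fun h => h.elim (fun h => h.elim (self _ _ _) (self _ _ _)) (self _ _ _),
      ⟨ihl _, ihm _, ne _ _ _ _ _ (by decide)⟩, ihu _, ne _ _ _ _ _ (by decide),
      ne _ _ _ _ _ (by decide)⟩

theorem IsSTTree.length_le_of_mem_nodesFrom {T h : ℕ} {t : STTree α} (H : IsSTTree T h t)
    {q y : Pos} (hy : y ∈ t.nodesFrom q) : y.length ≤ q.length + h := by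
  induction H generalizing q with
  | leaf => simp only [nodesFrom, List.mem_singleton] at hy; rw [hy]; omega
  | node2 h r l m hr hl hm rl rm ihl ihm =>
    simp only [nodesFrom, List.mem_cons, List.mem_append] at hy
    rcases hy with rfl | hy | hy
    · omega
    · have := ihl hy; simp at this; omega
    · have := ihm hy; simp at this; omega
  | upperLeft h r l m u t hr hT hb ht hl hm hu rl rm ru ihl ihm ihu =>
    simp only [nodesFrom, List.mem_cons, List.mem_append] at hy
    rcases hy with rfl | (hy | hy) | hy
    · omega
    · have := ihl hy; simp at this; omega
    · have := ihm hy; simp at this; omega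
    · have := ihu hy; simp at this; omega
  | upperRight h r l m u t hr hT hb ht hl hm hu rl rm ru ihl ihm ihu =>
    simp only [nodesFrom, List.mem_cons, List.mem_append] at hy
    rcases hy with rfl | (hy | hy) | hy
    · omega
    · have := ihl hy; simp at this; omega
    · have := ihm hy; simp at this; omega
    · have := ihu hy; simp at this; omega

/-- The nodes examined on the way down are children of nodes above the leaf that is reached. -/
theorem descend_fst_eq_cons {i v : ℕ} {t : STTree α} {q y : Pos}
    (hy : y ∈ (t.descend i v q).1) :
    ∃ e p, y = e :: p ∧ p <:+ (t.descend i v q).2 ∧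
      p.length < (t.descend i v q).2.length ∧ y ∈ t.nodesFrom q := by
  have fin : ∀ (s : STTree α) (q : Pos) (e : Fin 3), q <:+ (s.descend i v (e :: q)).2 ∧
      q.length < (s.descend i v (e :: q)).2.length := by
    intro s q e
    rw [descend_snd_eq_append]
    exact ⟨(List.suffix_cons _ _).trans (List.suffix_append _ _), by simp; omega⟩
  have hself : ∀ (s : STTree α) (q : Pos), q ∈ s.nodesFrom q := by
    intro s q; cases s <;> simp [nodesFrom]
  induction t generalizing q with
  | leaf => simp [descend] at hy
  | node2 r l m ihl ihm =>
    simp only [descend, nodesFrom] at hy ⊢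
    split_ifs at hy ⊢
    · rcases List.mem_cons.1 hy with rfl | hy
      · exact ⟨0, q, rfl, (fin _ _ _).1, (fin _ _ _).2, by simp [hself]⟩
      · obtain ⟨e, p, h1, h2, h3, h4⟩ := ihl hy
        exact ⟨e, p, h1, h2, h3, by simp [h4]⟩
    · rcases List.mem_cons.1 hy with rfl | hy
      · exact ⟨1, q, rfl, (fin _ _ _).1, (fin _ _ _).2, by simp [hself]⟩
      · obtain ⟨e, p, h1, h2, h3, h4⟩ := ihm hy
        exact ⟨e, p, h1, h2, h3, by simp [h4]⟩
  | node3 r l m u ihl ihm ihu =>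
    simp only [descend, nodesFrom] at hy ⊢
    split_ifs at hy ⊢
    · rcases List.mem_cons.1 hy with rfl | hy
      · exact ⟨0, q, rfl, (fin _ _ _).1, (fin _ _ _).2, by simp [hself]⟩
      · obtain ⟨e, p, h1, h2, h3, h4⟩ := ihl hy
        exact ⟨e, p, h1, h2, h3, by simp [h4]⟩
    · rcases List.mem_cons.1 hy with rfl | hy
      · exact ⟨0, q, rfl, (fin _ _ _).1, (fin _ _ _).2, by simp [hself]⟩
      rcases List.mem_cons.1 hy with rfl | hy
      · exact ⟨2, q, rfl, (fin _ _ _).1, (fin _ _ _).2, by simp [hself]⟩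
      · obtain ⟨e, p, h1, h2, h3, h4⟩ := ihu hy
        exact ⟨e, p, h1, h2, h3, by simp [h4]⟩
    · rcases List.mem_cons.1 hy with rfl | hy
      · exact ⟨1, q, rfl, (fin _ _ _).1, (fin _ _ _).2, by simp [hself]⟩
      · obtain ⟨e, p, h1, h2, h3, h4⟩ := ihm hy
        exact ⟨e, p, h1, h2, h3, by simp [h4]⟩
    · rcases List.mem_cons.1 hy with rfl | hy
      · exact ⟨1, q, rfl, (fin _ _ _).1, (fin _ _ _).2, by simp [hself]⟩
      rcases List.mem_cons.1 hy with rfl | hy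
      · exact ⟨2, q, rfl, (fin _ _ _).1, (fin _ _ _).2, by simp [hself]⟩
      · obtain ⟨e, p, h1, h2, h3, h4⟩ := ihu hy
        exact ⟨e, p, h1, h2, h3, by simp [h4]⟩

/-- The nodes examined on the way down are visited in the order of the layout. -/
theorem IsSTTree.pairwise_descend {T h n : ℕ} {t : STTree α} (H : IsSTTree T h t) {f : Pos → ℕ}
    (hchild : ∀ (p : Pos) (e : Fin 3), p.length + 1 < n → f p < f (e :: p))
    (hsib : ∀ (p : Pos) (e e' : Fin 3), p.length + 1 < n → e < e' → f (e :: p) < f (e' :: p))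
    (i v : ℕ) (q : Pos) (hq : q.length + h < n) :
    (q :: (t.descend i v q).1).Pairwise fun x y => f x < f y := by
  have one : ∀ (q : Pos) (e : Fin 3) (L : List Pos), q.length + 1 < n →
      ((e :: q) :: L).Pairwise (fun x y => f x < f y) →
      (q :: (e :: q) :: L).Pairwise (fun x y => f x < f y) := by
    intro q e L hq hL
    refine List.pairwise_cons.2 ⟨?_, hL⟩
    intro y hy
    have h1 := hchild q e hq
    rcases List.mem_cons.1 hy with rfl | hy
    · exact h1
    · exact h1.trans ((List.pairwise_cons.1 hL).1 y hy)
  have two : ∀ (q : Pos) (e e' : Fin 3) (L : List Pos), q.length + 1 < n → e < e' →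
      ((e' :: q) :: L).Pairwise (fun x y => f x < f y) →
      (q :: (e :: q) :: (e' :: q) :: L).Pairwise (fun x y => f x < f y) := by
    intro q e e' L hq he hL
    refine one q e _ hq (List.pairwise_cons.2 ⟨?_, hL⟩)
    intro y hy
    have h1 := hsib q e e' hq he
    rcases List.mem_cons.1 hy with rfl | hy
    · exact h1
    · exact h1.trans ((List.pairwise_cons.1 hL).1 y hy)
  induction H generalizing q with
  | leaf => simp [descend]
  | node2 h r l m hr hl hm rl rm ihl ihm =>
    simp only [descend]
    split_ifs
    · exact one _ _ _ (by omega) (ihl _ (by simp; omega))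
    · exact one _ _ _ (by omega) (ihm _ (by simp; omega))
  | upperLeft h r l m u t hr hT hb ht hl hm hu rl rm ru ihl ihm ihu =>
    simp only [descend]
    split_ifs
    · exact one _ _ _ (by omega) (ihl _ (by simp; omega))
    · exact two _ _ _ _ (by omega) (by decide) (ihu _ (by simp; omega))
    · exact one _ _ _ (by omega) (ihm _ (by simp; omega))
    · exact two _ _ _ _ (by omega) (by decide) (ihu _ (by simp; omega))
  | upperRight h r l m u t hr hT hb ht hl hm hu rl rm ru ihl ihm ihu =>
    simp only [descend]
    split_ifs
    · exact one _ _ _ (by omega) (ihl _ (by simp; omega))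
    · exact two _ _ _ _ (by omega) (by decide) (ihu _ (by simp; omega))
    · exact one _ _ _ (by omega) (ihm _ (by simp; omega))
    · exact two _ _ _ _ (by omega) (by decide) (ihu _ (by simp; omega))

theorem suffix_of_mem_climb {t : STTree α} {i v : ℕ} {q y : Pos} (hy : y ∈ (t.climb i v q).1) :
    y <:+ q := by
  induction q with
  | nil => simp [climb] at hy; rw [hy]
  | cons d q ih =>
    rw [climb] at hy
    split_ifs at hy
    · simp only [List.mem_singleton] at hy; rw [hy]
    · rcases List.mem_cons.1 hy with rfl | hy
      · exact List.suffix_rfl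
      · exact (ih hy).trans (List.suffix_cons _ _)

theorem climb_snd_holds_or (t : STTree α) (i v : ℕ) (q : Pos) :
    t.holds i v (t.climb i v q).2 ∨ (t.climb i v q).2 = [] := by
  induction q with
  | nil => exact .inr rfl
  | cons d q ih =>
    rw [climb]
    split_ifs with h
    · exact .inl h
    · exact ih

/-- Parents precede their children in the layout, so a climb runs backwards. -/
theorem pairwise_climb {n : ℕ} (t : STTree α) {f : Pos → ℕ}
    (hchild : ∀ (p : Pos) (e : Fin 3), p.length + 1 < n → f p < f (e :: p))
    (i v : ℕ) (q : Pos) (hq : q.length < n) :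
    (t.climb i v q).1.Pairwise fun x y => f y < f x := by
  have hle : ∀ q : Pos, q.length < n → ∀ y ∈ (t.climb i v q).1, f y ≤ f q := by
    intro q
    induction q with
    | nil => intro _ y hy; simp [climb] at hy; rw [hy]
    | cons d q ih =>
      intro hq y hy
      rw [List.length_cons] at hq
      rw [climb] at hy
      split_ifs at hy
      · simp only [List.mem_singleton] at hy; rw [hy]
      · rcases List.mem_cons.1 hy with rfl | hy
        · exact le_rfl
        · exact (ih (by omega) y hy).trans (hchild q d hq).le
  induction q with
  | nil => simp [climb]
  | cons d q ih =>
    rw [List.length_cons] at hq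
    rw [climb]
    split_ifs
    · simp
    · exact List.pairwise_cons.2
        ⟨fun y hy => (hle q (by omega) y hy).trans_lt (hchild q d hq), ih (by omega)⟩

/-- If the rectangle of a node contains `(i, v)`, then so does that of the root, and the way down
from the node leads to the same leaf as the way down from the root. -/
theorem IsSTTree.descend_of_holds {T h : ℕ} {t : STTree α} (H : IsSTTree T h t) {i v : ℕ}
    {q : Pos} {s : STTree α} (hs : t.at? q = some s) (hc : s.rect.Contains i v) :
    t.rect.Contains i v ∧ (s.descend i v q).2.reverse = leafDirs i v t := by
  obtain ⟨h1, h2⟩ := H.descend_follow hs hc []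
  rw [List.reverse_reverse, List.append_nil] at h2
  exact ⟨h1, by rw [leafDirs, h2]⟩

theorem at_suffix {t : STTree α} {q p : Pos} (hq : (t.at? q).isSome) (hp : p <:+ q) :
    (t.at? p).isSome := by
  obtain ⟨x, rfl⟩ := hp
  rw [at?, List.reverse_append, follow_append] at hq
  rw [at?]
  cases h : t.follow p.reverse with
  | none => simp [h] at hq
  | some _ => rfl

theorem follow_of_mem_nodesFrom {t : STTree α} {q y : Pos} (h : y ∈ t.nodesFrom q) :
    ∃ ds, y = ds.reverse ++ q ∧ (t.follow ds).isSome := by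
  induction t generalizing q with
  | leaf =>
    simp only [nodesFrom, List.mem_singleton] at h
    exact ⟨[], by simp [h], rfl⟩
  | node2 r l m ihl ihm =>
    simp only [nodesFrom, List.mem_cons, List.mem_append] at h
    rcases h with h | h | h
    · exact ⟨[], by simp [h], rfl⟩
    · obtain ⟨ds, h1, h2⟩ := ihl h; exact ⟨0 :: ds, by simp [h1], by simpa [follow]⟩
    · obtain ⟨ds, h1, h2⟩ := ihm h; exact ⟨1 :: ds, by simp [h1], by simpa [follow]⟩
  | node3 r l m u ihl ihm ihu =>
    simp only [nodesFrom, List.mem_cons, List.mem_append] at h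
    rcases h with h | (h | h) | h
    · exact ⟨[], by simp [h], rfl⟩
    · obtain ⟨ds, h1, h2⟩ := ihl h; exact ⟨0 :: ds, by simp [h1], by simpa [follow]⟩
    · obtain ⟨ds, h1, h2⟩ := ihm h; exact ⟨1 :: ds, by simp [h1], by simpa [follow]⟩
    · obtain ⟨ds, h1, h2⟩ := ihu h; exact ⟨2 :: ds, by simp [h1], by simpa [follow]⟩

theorem mem_nodes_iff {t : STTree α} {q : Pos} : q ∈ t.nodes ↔ (t.at? q).isSome := by
  refine ⟨fun h => ?_, mem_nodes_of_at⟩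
  obtain ⟨ds, rfl, h2⟩ := follow_of_mem_nodesFrom h
  simpa [at?] using h2

theorem mem_nodes_of_descend {t s : STTree α} {i v : ℕ} {q y : Pos} (hs : t.at? q = some s)
    (hy : y ∈ (s.descend i v q).1) : y ∈ t.nodes := by
  obtain ⟨e, p, -, -, -, hy⟩ := descend_fst_eq_cons hy
  obtain ⟨ds, rfl, h2⟩ := follow_of_mem_nodesFrom hy
  rw [mem_nodes_iff, at?, List.reverse_append, List.reverse_reverse, follow_append]
  rw [at?] at hs
  simpa [hs] using h2

end STTree

/-! ### Ranks in a list -/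

theorem countP_lt_countP {β : Type*} {f : β → ℕ} {l : List β} {x y : β} (hx : x ∈ l)
    (h : f x < f y) : l.countP (fun z => decide (f z < f x)) <
      l.countP fun z => decide (f z < f y) := by
  induction l with
  | nil => simp at hx
  | cons a l ih =>
    have hmono : l.countP (fun z => decide (f z < f x)) ≤
        l.countP fun z => decide (f z < f y) :=
      List.countP_mono_left fun z _ hz => by simp only [decide_eq_true_eq] at hz ⊢; omega
    simp only [List.countP_cons, decide_eq_true_eq]
    rcases List.mem_cons.1 hx with rfl | hx
    · rw [if_neg (lt_irrefl _), if_pos h]; omega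
    · have := ih hx
      split_ifs <;> omega

theorem countP_le_countP {β : Type*} {f : β → ℕ} (l : List β) {a b : ℕ} (h : a ≤ b) :
    l.countP (fun z => decide (f z < a)) ≤ l.countP fun z => decide (f z < b) :=
  List.countP_mono_left fun z _ hz => by simp only [decide_eq_true_eq] at hz ⊢; omega

/-- By injectivity each of the `d` additional values is taken at most once. Hence dropping the
missing nodes does not stretch a part of the layout. -/
theorem countP_le_countP_add {β : Type*} {f : β → ℕ} {l : List β} (hl : l.Nodup)
    (hf : ∀ x ∈ l, ∀ y ∈ l, f x = f y → x = y) (a d : ℕ) :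
    l.countP (fun z => decide (f z < a + d)) ≤ l.countP (fun z => decide (f z < a)) + d := by
  induction d with
  | zero => simp
  | succ d ih =>
    refine le_trans ?_ (Nat.succ_le_succ ih)
    clear ih
    induction l with
    | nil => simp
    | cons x l ih =>
      obtain ⟨h1, h2⟩ := List.nodup_cons.1 hl
      have ih := ih h2 fun y hy z hz => hf y (by simp [hy]) z (by simp [hz])
      simp only [List.countP_cons, decide_eq_true_eq]
      by_cases hx : f x = a + d
      · have : l.countP (fun z => decide (f z < a + (d + 1))) =
            l.countP (fun z => decide (f z < a + d)) := by
          refine List.countP_congr fun z hz => ?_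
          have hne : f z ≠ f x := fun h => h1 (hf z (by simp [hz]) x (by simp) h ▸ hz)
          simp only [decide_eq_true_eq]
          omega
        rw [this]
        split_ifs <;> omega
      · split_ifs <;> omega

end COPersistence

namespace COPersistence

namespace STTree

variable {α : Type*}

theorem descend_snd_mem_nodesFrom (i v : ℕ) (t : STTree α) (q : Pos) :
    (t.descend i v q).2 ∈ t.nodesFrom q := by
  induction t generalizing q with
  | leaf => simp [descend, nodesFrom]
  | node2 r l m ihl ihm =>
    simp only [descend, nodesFrom]
    split_ifs <;> simp [ihl, ihm]
  | node3 r l m u ihl ihm ihu =>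
    simp only [descend, nodesFrom]
    split_ifs <;> simp [ihl, ihm, ihu]

theorem reverse_leafDirs_mem_nodes (i v : ℕ) (t : STTree α) :
    (leafDirs i v t).reverse ∈ t.nodes := by
  rw [leafDirs, List.reverse_reverse]
  exact descend_snd_mem_nodesFrom i v t []

end STTree

namespace Store

variable {α : Type*}

/-! ### The trees of the structure -/

/-- The trees of the structure are space-time trees which cover the versions in order. -/
structure IsValid (S : Store α) : Prop where
  bottom : ∀ j t, S.bottom[j]? = some t → (∃ T, STTree.IsSTTree T S.logU t) ∧
    t.rect = ⟨0, S.U, j * S.U + 1, some ((j + 1) * S.U)⟩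
  top : STTree.IsSTTree S.vers S.logU S.top
  rect_top : S.top.rect = ⟨0, S.U, S.bottom.length * S.U + 1, none⟩
  vers_le : S.vers ≤ (S.bottom.length + 1) * S.U
  le_vers : S.bottom.length * S.U ≤ S.vers
  length_log : S.log.length = S.vers

/-- A structure in which the top tree contains a version, unless there are no versions yet. -/
structure IsCurrent (S : Store α) : Prop extends IsValid S where
  lt_vers : 0 < S.vers → S.bottom.length * S.U < S.vers

theorem U_pos (S : Store α) : 0 < S.U := Nat.pow_pos (by norm_num)

theorem isCurrent_init [Inhabited α] (n : ℕ) : (init n : Store α).IsCurrent where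
  bottom := by simp [init]
  top := STTree.isSTTree_complete _ _ _ _ _
  rect_top := by rw [init, STTree.rect_complete]; simp [U]
  vers_le := Nat.zero_le _
  le_vers := by simp [init]
  length_log := rfl
  lt_vers := fun h => absurd h (lt_irrefl 0)

theorem IsCurrent.refresh {S : Store α} (H : S.IsCurrent) :
    S.refresh.IsValid ∧ S.refresh.vers < (S.refresh.bottom.length + 1) * S.refresh.U ∧
      S.refresh.vers = S.vers := by
  have hU := S.U_pos
  have h1 := H.vers_le
  have h2 := H.le_vers
  rw [Nat.add_mul, one_mul] at h1
  unfold Store.refresh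
  split_ifs with h
  · obtain ⟨h0, k, hk⟩ := h
    -- The number of versions is a multiple of `S.U`, above `S.bottom.length` and at most
    -- `S.bottom.length + 1` times `S.U`; this is where `lt_vers` is needed.
    have h3 : S.vers = (S.bottom.length + 1) * S.U := by
      have h4 := H.lt_vers h0
      have h5 : S.bottom.length < k := by
        rw [hk, mul_comm] at h4
        exact lt_of_mul_lt_mul_left h4 hU.le
      have h6 : S.U * k ≤ S.U * (S.bottom.length + 1) := by
        rw [← hk, Nat.mul_add, mul_one, mul_comm]; exact h1
      have h7 := le_of_mul_le_mul_left h6 hU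
      rw [hk, mul_comm, (by omega : k = S.bottom.length + 1)]
    refine ⟨⟨?_, STTree.isSTTree_complete _ _ _ _ _, ?_, ?_, ?_, H.length_log⟩, ?_, rfl⟩
    · intro j t ht
      simp only [List.getElem?_append] at ht
      split_ifs at ht with hj
      · exact H.bottom j t ht
      · obtain ⟨hj', rfl⟩ : j = S.bottom.length ∧ S.top.close S.vers = t := by
          have : j - S.bottom.length = 0 := by
            by_contra hne
            rw [List.getElem?_eq_none (by simp; omega)] at ht
            simp at ht
          rw [this] at ht
          exact ⟨by omega, by simpa using ht⟩
        refine ⟨⟨_, H.top.close le_rfl⟩, ?_⟩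
        rw [STTree.rect_close, H.rect_top, hj', Rect.close]
        change Rect.mk _ _ _ _ = Rect.mk _ _ _ (some ((S.bottom.length + 1) * S.U))
        rw [← h3]
        rfl
    · rw [STTree.rect_complete]
      simp only [List.length_append, List.length_singleton]
      simp [U, h3]
    · simp only [List.length_append, List.length_singleton]
      change S.vers ≤ (S.bottom.length + 1 + 1) * S.U
      rw [h3, Nat.add_mul (S.bottom.length + 1)]
      exact Nat.le_add_right _ _
    · simp only [List.length_append, List.length_singleton]
      exact h3.ge
    · simp only [List.length_append, List.length_singleton]
      change S.vers < (S.bottom.length + 1 + 1) * S.U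
      rw [h3, Nat.add_mul (S.bottom.length + 1), one_mul]
      exact Nat.lt_add_of_pos_right hU
  · refine ⟨H.toIsValid, ?_, rfl⟩
    refine lt_of_le_of_ne H.vers_le fun h3 => h ⟨?_, ?_⟩
    · rw [h3]; exact Nat.mul_pos (Nat.succ_pos _) hU
    · rw [h3]; exact dvd_mul_left _ _

theorem IsCurrent.writeIn {S : Store α} (H : S.IsCurrent) (w : ℕ × α) :
    (S.writeIn w).IsCurrent ∧ (S.writeIn w).vers = S.vers + 1 := by
  obtain ⟨h1, h2, h3⟩ := H.refresh
  refine ⟨⟨⟨h1.bottom, ?_, ?_, h2, h1.le_vers.trans (Nat.le_succ _), ?_⟩,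
    fun _ => Nat.lt_succ_of_le h1.le_vers⟩, ?_⟩
  · exact h1.top.insert (by rw [h1.rect_top]) (Nat.le_succ _)
      (by rw [h1.rect_top]; have := h1.le_vers; simp only; omega) _ _ _
  · exact (STTree.rect_insert _ _ _ _ _).trans h1.rect_top
  · simpa [Store.writeIn] using h1.length_log
  · rw [← h3]; rfl

theorem IsCurrent.foldl_writeIn {S : Store α} (H : S.IsCurrent) (ws : List (ℕ × α)) :
    (ws.foldl Store.writeIn S).IsCurrent ∧
      (ws.foldl Store.writeIn S).vers = S.vers + ws.length := by
  induction ws generalizing S with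
  | nil => exact ⟨H, rfl⟩
  | cons w ws ih =>
    obtain ⟨h1, h2⟩ := H.writeIn w
    obtain ⟨h3, h4⟩ := ih h1
    refine ⟨h3, ?_⟩
    rw [List.foldl_cons, h4, h2, List.length_cons]
    omega

/-- Rebuilding replays the whole log, so the count of versions survives because of `length_log`. -/
theorem IsCurrent.write [Inhabited α] {S : Store α} (H : S.IsCurrent) (w : ℕ × α) :
    (S.write w).IsCurrent ∧ (S.write w).vers = S.vers + 1 := by
  unfold Store.write
  split_ifs
  · exact H.writeIn w
  · obtain ⟨h1, h2⟩ := (isCurrent_init (α := α) (Nat.clog 2 (w.1 + 1))).foldl_writeIn S.log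
    obtain ⟨h3, h4⟩ := h1.writeIn w
    refine ⟨h3, ?_⟩
    rw [h4, h2, H.length_log]
    simp [init]

theorem isCurrent_run [Inhabited α] (ws : List (ℕ × α)) :
    (run ws).IsCurrent ∧ (run ws).vers = ws.length := by
  have key : ∀ (ws : List (ℕ × α)) (S : Store α), S.IsCurrent →
      (ws.foldl Store.write S).IsCurrent ∧
        (ws.foldl Store.write S).vers = S.vers + ws.length := by
    intro ws
    induction ws with
    | nil => intro S H; exact ⟨H, rfl⟩
    | cons w ws ih =>
      intro S H
      obtain ⟨h1, h2⟩ := H.write w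
      obtain ⟨h3, h4⟩ := ih _ h1
      refine ⟨h3, ?_⟩
      rw [List.foldl_cons, h4, h2, List.length_cons]
      omega
  have := key ws (init 0) (isCurrent_init 0)
  simpa [run, init] using this

theorem trees_of_lt {S : Store α} {j : ℕ} (h : j < S.bottom.length) :
    S.trees[j]? = S.bottom[j]? := by
  rw [trees, List.getElem?_append_left h]

theorem trees_length (S : Store α) : S.trees[S.bottom.length]? = some S.top := by
  simp [trees]

theorem trees_eq_some {S : Store α} {j : ℕ} {t : STTree α} (h : S.trees[j]? = some t) :
    j < S.bottom.length ∧ S.bottom[j]? = some t ∨ j = S.bottom.length ∧ t = S.top := by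
  rcases Nat.lt_trichotomy j S.bottom.length with h1 | h1 | h1
  · exact .inl ⟨h1, by rwa [trees_of_lt h1] at h⟩
  · subst h1
    rw [trees_length] at h
    exact .inr ⟨rfl, (Option.some.inj h).symm⟩
  · rw [trees, List.getElem?_eq_none (by simp; omega)] at h
    simp at h

theorem IsValid.isSTTree {S : Store α} (H : S.IsValid) {j : ℕ} {t : STTree α}
    (h : S.trees[j]? = some t) :
    (∃ T, STTree.IsSTTree T S.logU t) ∧ t.rect.left = 0 ∧ t.rect.width = S.U := by
  rcases trees_eq_some h with ⟨-, h⟩ | ⟨-, rfl⟩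
  · obtain ⟨h1, h2⟩ := H.bottom j t h
    exact ⟨h1, by rw [h2], by rw [h2]⟩
  · exact ⟨⟨_, H.top⟩, by rw [H.rect_top], by rw [H.rect_top]⟩

/-- Versions are counted from 1 and trees from 0, hence `v - 1`; the bound `vers_le` keeps the
quotient within the array of trees. -/
theorem IsValid.exists_tree {S : Store α} (H : S.IsValid) {v : ℕ} (hv : 1 ≤ v)
    (hv' : v ≤ S.vers) : ∃ t, S.trees[(v - 1) / S.U]? = some t ∧
      ∀ i < S.U, t.rect.Contains i v := by
  have hU := S.U_pos
  have h1 := Nat.div_mul_le_self (v - 1) S.U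
  have h2 := Nat.lt_div_mul_add (a := v - 1) hU
  set j := (v - 1) / S.U with hj
  have h3 : j ≤ S.bottom.length := by
    have : j < S.bottom.length + 1 := by
      rw [hj, Nat.div_lt_iff_lt_mul hU]
      have := H.vers_le
      omega
    omega
  rcases h3.lt_or_eq with h3 | h3
  · rw [trees_of_lt h3, List.getElem?_eq_getElem h3]
    refine ⟨_, rfl, fun i hi => ?_⟩
    rw [Rect.contains_iff (H.bottom j _ (List.getElem?_eq_getElem h3)).2]
    refine ⟨Nat.zero_le _, by omega, by omega, ?_⟩
    rintro _ ⟨⟩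
    rw [Nat.add_mul, one_mul]
    omega
  · rw [h3, trees_length]
    refine ⟨_, rfl, fun i hi => ?_⟩
    rw [Rect.contains_iff H.rect_top, ← h3]
    exact ⟨Nat.zero_le _, by omega, by omega, by simp⟩

end Store
end COPersistence

namespace COPersistence

namespace Store

variable {α : Type*}

/-! ### Records and blocks -/

/-- The address of the record of a node. -/
noncomputable def recordAddr (S : Store α) (ε : ℝ) (A : Placement) (j : ℕ) (q : Pos) : ℕ :=
  A.tree j + 12 * S.recordIndex ε ⟨j, q⟩

theorem flatMap_cells_record (S : Store α) (ε : ℝ) (A : Placement) (j : ℕ) (ys : List Pos) :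
    ((ys.map fun q => Access.record ⟨j, q⟩).flatMap (S.cells ε A)) =
      (ys.map (S.recordAddr ε A j)).flatMap (recordCells (11 + 1)) := by
  rw [List.flatMap_map, List.flatMap_map]
  rfl

/-- In a bottom tree the ranks differ because `y` exists and is itself counted for `z`. -/
theorem recordIndex_lt {S : Store α} {ε : ℝ} {j : ℕ} {t : STTree α} (ht : S.trees[j]? = some t)
    {y z : Pos} (hy : y ∈ t.nodes)
    (h : vebIndex ε (S.logU + 1) y.reverse < vebIndex ε (S.logU + 1) z.reverse) :
    S.recordIndex ε ⟨j, y⟩ < S.recordIndex ε ⟨j, z⟩ := by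
  unfold recordIndex
  rcases trees_eq_some ht with ⟨hj, hb⟩ | ⟨rfl, rfl⟩
  · simp only [if_pos hj, hb, Option.elim_some]
    exact countP_lt_countP (f := fun q : Pos => vebIndex ε (S.logU + 1) q.reverse) hy h
  · simpa using h

theorem recordIndex_part {S : Store α} (H : S.IsValid) {ε : ℝ} {j : ℕ} {t : STTree α}
    (ht : S.trees[j]? = some t) {N : ℕ} (hN : 1 ≤ N) {y : Pos} (hy : y ∈ t.nodes) :
    S.recordIndex ε ⟨j, (y.reverse.take (lastCut ε N (S.logU + 1) y.reverse.length)).reverse⟩ ≤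
        S.recordIndex ε ⟨j, y⟩ ∧ S.recordIndex ε ⟨j, y⟩ <
      S.recordIndex ε ⟨j, (y.reverse.take (lastCut ε N (S.logU + 1) y.reverse.length)).reverse⟩ +
        3 ^ N := by
  obtain ⟨T, hT⟩ := (H.isSTTree ht).1
  have hlen : ∀ z ∈ t.nodes, z.reverse.length < S.logU + 1 := by
    intro z hz
    have := hT.length_le_of_mem_nodesFrom hz
    simp only [List.length_nil] at this
    rw [List.length_reverse]
    omega
  obtain ⟨h1, h2⟩ := vebIndex_take_lastCut (ε := ε) hN (hlen y hy)
  unfold recordIndex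
  rcases trees_eq_some ht with ⟨hj, hb⟩ | ⟨rfl, rfl⟩
  · simp only [if_pos hj, hb, Option.elim_some, List.reverse_reverse]
    refine ⟨countP_le_countP (f := fun q : Pos => vebIndex ε (S.logU + 1) q.reverse) _ h1, ?_⟩
    obtain ⟨d, hd⟩ := Nat.exists_eq_add_of_le h1
    have h3 := countP_le_countP_add (f := fun q : Pos => vebIndex ε (S.logU + 1) q.reverse)
      (show t.nodes.Nodup from STTree.nodup_nodesFrom t [])
      (fun z hz z' hz' h => List.reverse_injective
        (vebIndex_injective (hlen z hz) (hlen z' hz') h))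
      (vebIndex ε (S.logU + 1) (y.reverse.take (lastCut ε N (S.logU + 1) y.reverse.length))) d
    rw [← hd] at h3
    exact h3.trans_lt (by omega)
  · rw [if_neg (lt_irrefl _), if_neg (lt_irrefl _), List.reverse_reverse]
    exact ⟨h1, h2⟩

/-- Blocks that contain the part of tree `j` whose root is reached by the directions `κ`. -/
noncomputable def partBlocks (S : Store α) (ε : ℝ) (A : Placement) (N B j : ℕ)
    (κ : List (Fin 3)) : Finset ℕ :=
  Finset.Icc (S.recordAddr ε A j κ.reverse / B) ((S.recordAddr ε A j κ.reverse + 12 * 3 ^ N) / B)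

/-- A part has at most `12 * 3 ^ N ≤ 24 * B` words. -/
theorem card_partBlocks_le (S : Store α) (ε : ℝ) (A : Placement) {N B : ℕ} (hB : 0 < B)
    (hN : 3 ^ N ≤ 2 * B) (j : ℕ) (κ : List (Fin 3)) :
    (S.partBlocks ε A N B j κ).card ≤ 25 := by
  rw [partBlocks, Nat.card_Icc]
  generalize S.recordAddr ε A j κ.reverse = a
  have : (a + 12 * 3 ^ N) / B ≤ a / B + 24 := by
    rw [← Nat.add_mul_div_right a 24 hB]
    exact Nat.div_le_div_right (by omega)
  omega

/-- Blocks that contain the nodes on the way to a leaf and their children. -/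
noncomputable def leafBlocks (S : Store α) (ε : ℝ) (A : Placement) (N B j : ℕ)
    (ℓ : List (Fin 3)) : Finset ℕ :=
  (partRoots ε N (S.logU + 1) ℓ).biUnion (S.partBlocks ε A N B j)

theorem card_leafBlocks_le (S : Store α) (ε : ℝ) (A : Placement) {N B : ℕ} (hB : 0 < B)
    (hN : 3 ^ N ≤ 2 * B) (j : ℕ) (ℓ : List (Fin 3)) :
    (S.leafBlocks ε A N B j ℓ).card ≤ 100 * (cuts ε N (S.logU + 1)).length := by
  refine (Finset.card_biUnion_le_card_mul _ _ 25 fun κ _ =>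
    S.card_partBlocks_le ε A hB hN j κ).trans ?_
  have := card_partRoots_le ε N (S.logU + 1) ℓ
  omega

theorem div_mem_leafBlocks {S : Store α} (H : S.IsValid) {ε : ℝ} (A : Placement) {j : ℕ}
    {t : STTree α} (ht : S.trees[j]? = some t) {N : ℕ} (hN : 1 ≤ N) (B : ℕ) {ℓ : List (Fin 3)}
    {y : Pos} (hy : y ∈ t.nodes)
    (hyl : y <:+ ℓ.reverse ∨ ∃ e p, y = e :: p ∧ p <:+ ℓ.reverse) {k : ℕ} (hk : k ≤ 11) :
    (S.recordAddr ε A j y + k) / B ∈ S.leafBlocks ε A N B j ℓ := by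
  have take_of_suffix : ∀ {p : Pos}, p <:+ ℓ.reverse →
      p.length ≤ ℓ.length ∧ p.reverse = ℓ.take p.length := by
    intro p hp
    have h1 := List.reverse_prefix.2 hp
    rw [List.reverse_reverse] at h1
    exact ⟨by simpa using hp.length_le, by simpa using List.prefix_iff_eq_take.1 h1⟩
  refine Finset.mem_biUnion.2 ⟨y.reverse.take (lastCut ε N (S.logU + 1) y.reverse.length), ?_, ?_⟩
  · rcases hyl with h | ⟨e, p, rfl, h⟩
    · obtain ⟨h1, h2⟩ := take_of_suffix h
      rw [h2]
      exact take_lastCut_mem_partRoots _ _ _ _ h1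
    · obtain ⟨h1, h2⟩ := take_of_suffix h
      rw [List.reverse_cons, h2]
      exact take_append_lastCut_mem_partRoots _ _ _ _ h1 e
  · obtain ⟨h1, h2⟩ := recordIndex_part (ε := ε) H ht hN hy
    rw [partBlocks, Finset.mem_Icc, recordAddr, recordAddr]
    -- The record starts at most `12 * (3 ^ N - 1)` words after that of the root of its part, and `k
    -- ≤ 11`.
    exact ⟨Nat.div_le_div_right (by omega), Nat.div_le_div_right (by omega)⟩

/-- The blocks of the records of a list of nodes. -/
noncomputable def walkBlocks (S : Store α) (ε : ℝ) (A : Placement) (B j : ℕ) (ys : List Pos) :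
    List ℕ :=
  ((ys.map fun q => Access.record ⟨j, q⟩).flatMap (S.cells ε A)).map (· / B)

theorem mem_leafBlocks_of_mem_walkBlocks {S : Store α} (H : S.IsValid) {ε : ℝ} (A : Placement)
    {j : ℕ} {t : STTree α} (ht : S.trees[j]? = some t) {N : ℕ} (hN : 1 ≤ N) (B : ℕ)
    {ℓ : List (Fin 3)} {ys : List Pos} (hys : ∀ y ∈ ys, y ∈ t.nodes ∧
      (y <:+ ℓ.reverse ∨ ∃ e p, y = e :: p ∧ p <:+ ℓ.reverse)) :
    ∀ x ∈ S.walkBlocks ε A B j ys, x ∈ S.leafBlocks ε A N B j ℓ := by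
  intro x hx
  rw [walkBlocks, flatMap_cells_record] at hx
  simp only [recordCells, List.mem_map, List.mem_flatMap, List.mem_range] at hx
  obtain ⟨_, ⟨_, ⟨y, hy, rfl⟩, k, hk, rfl⟩, rfl⟩ := hx
  exact div_mem_leafBlocks H A ht hN B (hys y hy).1 (hys y hy).2 (by omega)

/-- The walk is monotone in memory and stays within the `100 * m` blocks of one leaf, where `m` is
the number of cuts; records of 12 words give the factor `2 * 12`. -/
theorem lruCost_walkBlocks_le {S : Store α} (H : S.IsValid) {ε : ℝ} (A : Placement)
    {j : ℕ} {t : STTree α} (ht : S.trees[j]? = some t) {N B : ℕ} (hN : 1 ≤ N) (hB : 0 < B)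
    (hNB : 3 ^ N ≤ 2 * B) {ℓ : List (Fin 3)} {ys : List Pos} (hys : ∀ y ∈ ys, y ∈ t.nodes ∧
      (y <:+ ℓ.reverse ∨ ∃ e p, y = e :: p ∧ p <:+ ℓ.reverse))
    (hord : (ys.Pairwise fun x y => vebIndex ε (S.logU + 1) x.reverse <
        vebIndex ε (S.logU + 1) y.reverse) ∨
      ys.Pairwise fun x y => vebIndex ε (S.logU + 1) y.reverse <
        vebIndex ε (S.logU + 1) x.reverse) {K : ℕ} (hK : 1 ≤ K) (r : List ℕ) :
    lruCost K r (S.walkBlocks ε A B j ys) ≤ 2400 * (cuts ε N (S.logU + 1)).length := by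
  have hcard := S.card_leafBlocks_le ε A hB hNB j ℓ
  rw [walkBlocks, flatMap_cells_record]
  refine (lruCost_records_le_card hK 11 (β := (· / B)) (fun a b h => Nat.div_le_div_right h)
    (ys.map (S.recordAddr ε A j)) r (S.leafBlocks ε A N B j ℓ) ?_ ?_).trans (by omega)
  · intro a ha k hk
    obtain ⟨y, hy, rfl⟩ := List.mem_map.1 ha
    exact div_mem_leafBlocks H A ht hN B (hys y hy).1 (hys y hy).2 hk
  · refine hord.imp (fun h => List.pairwise_map.2 ?_) fun h => List.pairwise_map.2 ?_
    · refine h.imp_of_mem fun hx _ h => ?_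
      have := recordIndex_lt ht (hys _ hx).1 h
      simp only [recordAddr]
      omega
    · refine h.imp_of_mem fun _ hy h => ?_
      have := recordIndex_lt ht (hys _ hy).1 h
      simp only [recordAddr]
      omega

/-! ### The way of a persistent read -/

theorem vebIndex_reverse_lt_child (ε : ℝ) (n : ℕ) (p : Pos) (e : Fin 3) (h : p.length + 1 < n) :
    vebIndex ε n p.reverse < vebIndex ε n (e :: p).reverse := by
  rw [List.reverse_cons]
  exact vebIndex_lt_child (by simpa using h)

theorem vebIndex_reverse_lt_sibling (ε : ℝ) (n : ℕ) (p : Pos) (e e' : Fin 3)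
    (h : p.length + 1 < n) (he : e < e') :
    vebIndex ε n (e :: p).reverse < vebIndex ε n (e' :: p).reverse := by
  rw [List.reverse_cons, List.reverse_cons]
  exact vebIndex_lt_sibling he (by simpa using h)

theorem climb_mem {t : STTree α} {i v : ℕ} {q : Pos} (hq : q ∈ t.nodes) :
    ∀ y ∈ (t.climb i v q).1, y ∈ t.nodes ∧
      (y <:+ q.reverse.reverse ∨ ∃ e p, y = e :: p ∧ p <:+ q.reverse.reverse) := by
  intro y hy
  have h := STTree.suffix_of_mem_climb hy
  refine ⟨STTree.mem_nodes_iff.2 (STTree.at_suffix (STTree.mem_nodes_iff.1 hq) h), .inl ?_⟩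
  rwa [List.reverse_reverse]

theorem descend_mem {t s : STTree α} {i v : ℕ} {q : Pos} (hs : t.at? q = some s)
    (hl : (s.descend i v q).2.reverse = STTree.leafDirs i v t) :
    ∀ y ∈ (s.descend i v q).1, y ∈ t.nodes ∧
      (y <:+ (STTree.leafDirs i v t).reverse ∨
        ∃ e p, y = e :: p ∧ p <:+ (STTree.leafDirs i v t).reverse) := by
  intro y hy
  obtain ⟨e, p, h1, h2, -, -⟩ := STTree.descend_fst_eq_cons hy
  refine ⟨STTree.mem_nodes_of_descend hs hy, .inr ⟨e, p, h1, ?_⟩⟩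
  rwa [← hl, List.reverse_reverse]

/-- The blocks accessed by a persistent read. -/
noncomputable def readBlocks (S : Store α) (ε : ℝ) (A : Placement) (B v : ℕ) (p : Pointer)
    (i : ℕ) : List ℕ :=
  ((S.persistentRead v i p).1.flatMap (S.cells ε A)).map (· / B)

theorem _root_.COPersistence.STTree.IsSTTree.follow {T h : ℕ} {t s : STTree α}
    (H : STTree.IsSTTree T h t) {ds : List (Fin 3)} (hs : t.follow ds = some s) :
    ∃ h', STTree.IsSTTree T h' s ∧ ds.length + h' = h := by
  have step : ∀ {h : ℕ} {d : Fin 3} {ds : List (Fin 3)},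
      (∃ h', STTree.IsSTTree T h' s ∧ ds.length + h' = h) →
      ∃ h', STTree.IsSTTree T h' s ∧ (d :: ds).length + h' = h + 1 := by
    rintro h d ds ⟨h', h1, h2⟩
    exact ⟨h', h1, by rw [List.length_cons]; omega⟩
  induction H generalizing ds with
  | leaf r point val hr =>
    cases ds with
    | nil => obtain rfl : _ = s := by simpa [STTree.follow] using hs
             exact ⟨0, .leaf _ _ _ hr, rfl⟩
    | cons d ds => simp [STTree.follow] at hs
  | node2 h r l m hr hl hm rl rm ihl ihm =>
    cases ds with
    | nil => obtain rfl : _ = s := by simpa [STTree.follow] using hs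
             exact ⟨_, .node2 _ _ _ _ hr hl hm rl rm, Nat.zero_add _⟩
    | cons d ds =>
      simp only [STTree.follow] at hs
      split_ifs at hs
      · exact step (ihl hs)
      · exact step (ihm hs)
  | upperLeft h r l m u t hr hT hb ht hl hm hu rl rm ru ihl ihm ihu =>
    cases ds with
    | nil => obtain rfl : _ = s := by simpa [STTree.follow] using hs
             exact ⟨_, .upperLeft _ _ _ _ _ _ hr hT hb ht hl hm hu rl rm ru, Nat.zero_add _⟩
    | cons d ds =>
      simp only [STTree.follow] at hs
      split_ifs at hs
      · exact step (ihl hs)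
      · exact step (ihm hs)
      · exact step (ihu hs)
  | upperRight h r l m u t hr hT hb ht hl hm hu rl rm ru ihl ihm ihu =>
    cases ds with
    | nil => obtain rfl : _ = s := by simpa [STTree.follow] using hs
             exact ⟨_, .upperRight _ _ _ _ _ _ hr hT hb ht hl hm hu rl rm ru, Nat.zero_add _⟩
    | cons d ds =>
      simp only [STTree.follow] at hs
      split_ifs at hs
      · exact step (ihl hs)
      · exact step (ihm hs)
      · exact step (ihu hs)

theorem pairwise_descend_of_at {S : Store α} {ε : ℝ} {T : ℕ} {t s : STTree α}
    (hT : STTree.IsSTTree T S.logU t) {q : Pos} (hs : t.at? q = some s) (i v : ℕ) :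
    (s.descend i v q).1.Pairwise fun x y => vebIndex ε (S.logU + 1) x.reverse <
        vebIndex ε (S.logU + 1) y.reverse := by
  obtain ⟨h', h1, h2⟩ := hT.follow hs
  rw [List.length_reverse] at h2
  exact (List.pairwise_cons.1 (h1.pairwise_descend (n := S.logU + 1)
    (f := fun q => vebIndex ε (S.logU + 1) q.reverse) (vebIndex_reverse_lt_child ε _)
    (vebIndex_reverse_lt_sibling ε _) i v q (by omega))).2

theorem read_of_holds {S : Store α} {v i : ℕ} {p : Pointer} {t : STTree α} {T h : ℕ}
    (ht : S.trees[p.tree]? = some t) (hT : STTree.IsSTTree T h t)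
    (hh : t.holds i v (t.climb i v p.pos).2) :
    ∃ s, t.at? (t.climb i v p.pos).2 = some s ∧ t.rect.Contains i v ∧
      (s.descend i v (t.climb i v p.pos).2).2.reverse = STTree.leafDirs i v t ∧
      S.persistentRead v i p =
        ([Access.pointer] ++ (t.climb i v p.pos).1.map (fun q => Access.record ⟨p.tree, q⟩) ++
          (s.descend i v (t.climb i v p.pos).2).1.map (fun q => Access.record ⟨p.tree, q⟩) ++
          [Access.pointer], ⟨p.tree, (STTree.leafDirs i v t).reverse⟩) := by
  have hh' := hh
  unfold STTree.holds at hh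
  split at hh
  · rename_i s hs
    obtain ⟨h1, h2⟩ := hT.descend_of_holds hs (of_decide_eq_true hh)
    refine ⟨s, hs, h1, h2, ?_⟩
    have h3 : S.at? ⟨p.tree, (t.climb i v p.pos).2⟩ = some s := by
      simp [Store.at?, ht, hs]
    simp only [persistentRead, ht, if_pos hh', goDown, h3, ← h2, List.reverse_reverse]
  · simp at hh

theorem read_of_not_holds {S : Store α} {v i : ℕ} {p : Pointer} {t t' : STTree α}
    (ht : S.trees[p.tree]? = some t) (ht' : S.trees[(v - 1) / S.U]? = some t')
    (hh : ¬ t.holds i v (t.climb i v p.pos).2) :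
    S.persistentRead v i p =
        ([Access.pointer] ++ (t.climb i v p.pos).1.map (fun q => Access.record ⟨p.tree, q⟩) ++
          [Access.size, Access.entry ((v - 1) / S.U), Access.record ⟨(v - 1) / S.U, []⟩] ++
          (t'.descend i v []).1.map (fun q => Access.record ⟨(v - 1) / S.U, q⟩) ++
          [Access.pointer], ⟨(v - 1) / S.U, (STTree.leafDirs i v t').reverse⟩) := by
  have h3 : S.at? ⟨(v - 1) / S.U, []⟩ = some t' := by
    simp [Store.at?, ht', STTree.at?, STTree.follow]
  simp only [persistentRead, ht, if_neg hh, goDown, h3, STTree.leafDirs, List.reverse_reverse]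

/-- A persistent read costs at most one block transfer for each part of the layout on its way, up
to a constant factor. -/
theorem IsValid.lruCost_readBlocks_le {S : Store α} (H : S.IsValid) (ε : ℝ) (A : Placement)
    {N B v i : ℕ} (hN : 1 ≤ N) (hB : 0 < B) (hNB : 3 ^ N ≤ 2 * B) {p : Pointer} {t : STTree α}
    (ht : S.trees[p.tree]? = some t) (hp : p.pos ∈ t.nodes) (hv : 1 ≤ v) (hv' : v ≤ S.vers) : (∃ j t', S.trees[j]? = some t' ∧ (∀ i < S.U, t'.rect.Contains i v) ∧
      (S.persistentRead v i p).2 = ⟨j, (STTree.leafDirs i v t').reverse⟩) ∧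
    ∀ K, 1 ≤ K → ∀ r, lruCost K r (S.readBlocks ε A B v p i) ≤
      4816 * (cuts ε N (S.logU + 1)).length := by
  obtain ⟨⟨T, hT⟩, hleft, hwidth⟩ := H.isSTTree ht
  have hcuts : 1 ≤ (cuts ε N (S.logU + 1)).length :=
    List.length_pos_of_mem (lastCut_mem_cuts ε N (S.logU + 1) 0)
  have hpl : p.pos.length < S.logU + 1 := by
    have := hT.length_le_of_mem_nodesFrom hp
    simp only [List.length_nil] at this
    omega
  have hclimb : ∀ K, 1 ≤ K → ∀ r,
      lruCost K r (S.walkBlocks ε A B p.tree (t.climb i v p.pos).1) ≤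
        2400 * (cuts ε N (S.logU + 1)).length := fun K hK r =>
    lruCost_walkBlocks_le H A ht hN hB hNB (climb_mem hp) (.inr (STTree.pairwise_climb
      (n := S.logU + 1) (f := fun q => vebIndex ε (S.logU + 1) q.reverse) t
      (vebIndex_reverse_lt_child ε _) i v p.pos hpl)) hK r
  by_cases hh : t.holds i v (t.climb i v p.pos).2
  · obtain ⟨s, h1, h2, h3, h4⟩ := read_of_holds ht hT hh
    refine ⟨⟨p.tree, t, ht, fun i' hi' => ?_, by rw [h4]⟩, fun K hK r => ?_⟩
    · obtain ⟨-, -, h5⟩ := h2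
      exact ⟨by rw [hleft]; omega, by rw [hleft, hwidth]; omega, h5⟩
    · have hdesc : ∀ r, lruCost K r (S.walkBlocks ε A B p.tree
          (s.descend i v (t.climb i v p.pos).2).1) ≤
          2400 * (cuts ε N (S.logU + 1)).length := fun r =>
        lruCost_walkBlocks_le H A ht hN hB hNB (descend_mem h1 h3)
          (.inl (pairwise_descend_of_at hT h1 i v)) hK r
      rw [readBlocks, h4]
      simp only [List.flatMap_append, List.map_append, lruCost_append, List.foldl_append]
      refine (Nat.add_le_add (Nat.add_le_add (Nat.add_le_add (lruCost_le_length _ _ _)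
        (hclimb K hK _)) (hdesc _)) (lruCost_le_length _ _ _)).trans ?_
      simp [cells]
      omega
  · obtain ⟨t', ht', hc⟩ := H.exists_tree hv hv'
    obtain ⟨⟨T', hT'⟩, -, -⟩ := H.isSTTree ht'
    have h4 := read_of_not_holds ht ht' hh
    have h1 : t'.at? [] = some t' := by simp [STTree.at?, STTree.follow]
    refine ⟨⟨_, t', ht', hc, by rw [h4]⟩, fun K hK r => ?_⟩
    have hdesc : ∀ r, lruCost K r (S.walkBlocks ε A B ((v - 1) / S.U) (t'.descend i v []).1) ≤
        2400 * (cuts ε N (S.logU + 1)).length := fun r =>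
      lruCost_walkBlocks_le H A ht' hN hB hNB (descend_mem h1 rfl)
        (.inl (pairwise_descend_of_at hT' h1 i v)) hK r
    rw [readBlocks, h4]
    simp only [List.flatMap_append, List.map_append, lruCost_append, List.foldl_append]
    refine (Nat.add_le_add (Nat.add_le_add (Nat.add_le_add (Nat.add_le_add
      (lruCost_le_length _ _ _) (hclimb K hK _)) (lruCost_le_length _ _ _)) (hdesc _))
      (lruCost_le_length _ _ _)).trans ?_
    -- Sixteen single words besides the two walks: two accesses to `p`, one to `U`, one to the array
    -- of trees, and the twelve words of the root. They are absorbed since there is at least one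
    -- cut.
    simp [cells, recordWords]
    omega

/-- Between two reads in the same tree, only the ways to the two leaves are accessed. -/
theorem IsValid.mem_of_mem_readBlocks {S : Store α} (H : S.IsValid) (ε : ℝ) (A : Placement)
    {N B v i i' j : ℕ} (hN : 1 ≤ N) {t : STTree α}
    (ht : S.trees[j]? = some t) (hc : t.rect.Contains i' v) :
    (S.persistentRead v i' ⟨j, (STTree.leafDirs i v t).reverse⟩).2 =
      ⟨j, (STTree.leafDirs i' v t).reverse⟩ ∧
    ∀ x ∈ S.readBlocks ε A B v ⟨j, (STTree.leafDirs i v t).reverse⟩ i',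
      x = A.globals / B ∨ x ∈ S.leafBlocks ε A N B j (STTree.leafDirs i v t) ∨
        x ∈ S.leafBlocks ε A N B j (STTree.leafDirs i' v t) := by
  obtain ⟨⟨T, hT⟩, -, -⟩ := H.isSTTree ht
  -- The root contains the new column in the same version, so the climb succeeds and the array of
  -- trees is not consulted.
  have hh : t.holds i' v (t.climb i' v (STTree.leafDirs i v t).reverse).2 := by
    rcases STTree.climb_snd_holds_or t i' v (STTree.leafDirs i v t).reverse with h | h
    · exact h
    · rw [h]
      simpa [STTree.holds, STTree.at?, STTree.follow] using hc
  obtain ⟨s, h1, h2, h3, h4⟩ :=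
    read_of_holds (p := ⟨j, (STTree.leafDirs i v t).reverse⟩) ht hT hh
  refine ⟨by rw [h4], fun x hx => ?_⟩
  rw [readBlocks, h4] at hx
  simp only [List.flatMap_append, List.map_append, List.mem_append] at hx
  rcases hx with ((hx | hx) | hx) | hx
  · exact .inl (by simpa [cells] using hx)
  · have hm := climb_mem (i := i') (v := v) (STTree.reverse_leafDirs_mem_nodes i v t)
    rw [List.reverse_reverse] at hm
    exact .inr (.inl (mem_leafBlocks_of_mem_walkBlocks H A ht hN B hm x hx))
  · exact .inr (.inr (mem_leafBlocks_of_mem_walkBlocks H A ht hN B (descend_mem h1 h3) x hx))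
  · exact .inl (by simpa [cells] using hx)

theorem map_persistentReads {S : Store α} (H : S.IsValid) (ε : ℝ) (A : Placement)
    {B v j : ℕ} {t : STTree α} (ht : S.trees[j]? = some t)
    (hc : ∀ i < S.U, t.rect.Contains i v) (i : ℕ) (X : List ℕ) (hX : ∀ x ∈ X, x < S.U) :
    ((S.persistentReads v ⟨j, (STTree.leafDirs i v t).reverse⟩ X).flatMap (S.cells ε A)).map
        (· / B) =
      chainAccesses (fun i x => S.readBlocks ε A B v ⟨j, (STTree.leafDirs i v t).reverse⟩ x) i X := by
  induction X generalizing i with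
  | nil => simp [persistentReads, chainAccesses]
  | cons x X ih =>
    -- Only the new position of the pointer is used, so `N = 1` will do.
    have h1 := (H.mem_of_mem_readBlocks ε A (B := B) (i := i) le_rfl ht
      (hc x (hX x List.mem_cons_self))).1
    rw [persistentReads, h1, List.flatMap_append, List.map_append,
      ih x fun y hy => hX y (List.mem_cons_of_mem _ hy), chainAccesses, readBlocks]

end Store
end COPersistence

namespace COPersistence

/-! ### Levels of the parts -/

/-- Number of levels of the parts which fit into a block. -/
def partLevels (B : ℕ) : ℕ := max 1 (Nat.log 3 B)

theorem one_le_partLevels (B : ℕ) : 1 ≤ partLevels B := le_max_left _ _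

/-- The factor 2 is caused by `B = 2`, where even a part with one level is charged `3 > B`. -/
theorem pow_partLevels_le {B : ℕ} (hB : 2 ≤ B) : 3 ^ partLevels B ≤ 2 * B := by
  rcases max_choice 1 (Nat.log 3 B) with h | h
  · rw [partLevels, h]; omega
  · rw [partLevels, h]
    have := Nat.pow_log_le_self 3 (x := B) (by omega)
    omega

theorem logb_lt_partLevels_add_one (B : ℕ) (hB : 2 ≤ B) :
    Real.logb 3 B < partLevels B + 1 := by
  rw [Real.logb_lt_iff_lt_rpow (by norm_num) (by positivity)]
  have h1 : B < 3 ^ (Nat.log 3 B + 1) := Nat.lt_pow_succ_log_self (by norm_num) B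
  have h2 : 3 ^ (Nat.log 3 B + 1) ≤ 3 ^ (partLevels B + 1) :=
    Nat.pow_le_pow_right (by norm_num) (Nat.succ_le_succ (le_max_right _ _))
  have h3 : (B : ℝ) < (3 : ℝ) ^ (partLevels B + 1) := by exact_mod_cast h1.trans_le h2
  rw [← Real.rpow_natCast] at h3
  exact_mod_cast h3

variable {ε : ℝ}

/-- The number of parts on a way from the root to a leaf is logarithmic to the base `B`. -/
theorem length_cuts_le_logb (h₀ : 0 < ε) (h₁ : ε < 1) {B : ℕ} (hB : 2 ≤ B) (n : ℕ) :
    ((cuts ε (partLevels B) (n + 1)).length : ℝ) ≤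
      8 / min ε (1 - ε) * (1 + Real.logb B (2 ^ n : ℕ)) := by
  have hδ : 0 < min ε (1 - ε) := lt_min h₀ (sub_pos.2 h₁)
  have hδ1 : min ε (1 - ε) ≤ 1 := (min_le_left _ _).trans h₁.le
  have hB' : (1 : ℝ) < B := by exact_mod_cast hB
  have hlogB : 0 < Real.log B := Real.log_pos hB'
  have hlog2 : 0 < Real.log 2 := Real.log_pos (by norm_num)
  have hlog3 : 0 < Real.log 3 := Real.log_pos (by norm_num)
  have hL : Real.logb B (2 ^ n : ℕ) = n * (Real.log 2 / Real.log B) := by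
    rw [Real.logb, Nat.cast_pow, Real.log_pow, Nat.cast_ofNat]
    ring
  rw [hL]
  set x := Real.log 2 / Real.log B with hx
  have hx0 : 0 < x := by positivity
  set δ := min ε (1 - ε)
  have hN : (1 : ℝ) ≤ partLevels B := by exact_mod_cast one_le_partLevels B
  rcases length_cuts_le h₀ h₁ (partLevels B) (n + 1) with h | h
  · rw [h, Nat.cast_one]
    have h1 : 1 ≤ 8 / δ := by rw [le_div_iff₀ hδ]; linarith
    have h2 : 1 ≤ 1 + n * x := by nlinarith [Nat.cast_nonneg (α := ℝ) n]
    nlinarith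
  -- With `N = partLevels B`: log B < (N + 1) log 3 ≤ 2N · 2 log 2.
  · have h3 : 1 ≤ 4 * (x * partLevels B) := by
      have h4 := logb_lt_partLevels_add_one B hB
      rw [Real.logb, div_lt_iff₀ hlog3] at h4
      have h5 : Real.log 3 ≤ 2 * Real.log 2 := by
        have h6 : Real.log (2 ^ 2) = 2 * Real.log 2 := by
          rw [Real.log_pow, Nat.cast_ofNat]
        rw [← h6]
        exact Real.log_le_log (by norm_num) (by norm_num)
      have h6 : Real.log B ≤ 4 * (Real.log 2 * partLevels B) := by nlinarith
      rw [hx, div_mul_eq_mul_div, ← mul_div_assoc, le_div_iff₀ hlogB]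
      linarith
    have hδN : 0 < δ / 2 * partLevels B := by positivity
    rw [← le_div_iff₀ hδN] at h
    refine h.trans ?_
    rw [div_le_iff₀ hδN]
    push_cast
    have h7 : 8 / δ * (1 + n * x) * (δ / 2 * partLevels B) =
        4 * partLevels B + n * (4 * (x * partLevels B)) := by
      field_simp
      ring
    rw [h7]
    have : (n : ℝ) * 1 ≤ n * (4 * (x * partLevels B)) := by gcongr
    linarith

/-- The parts at the bottom are wide. -/
theorem rpow_le_pow_sub_lastCut (h₀ : 0 < ε) (h₁ : ε < 1) {B : ℕ} (hB : 2 ≤ B) (n : ℕ) :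
    lastCut ε (partLevels B) (n + 1) n = 0 ∨
      (B : ℝ) ^ ((1 - ε) / Real.logb 2 3) ≤
        4 * 2 ^ (n - lastCut ε (partLevels B) (n + 1) n) := by
  refine (levels_sub_lastCut h₀ h₁ (one_le_partLevels B) (Nat.succ_pos n)).imp id fun h => ?_
  have hle := lastCut_le ε (partLevels B) (n + 1) n
  rw [Nat.succ_sub_one] at h
  set c := lastCut ε (partLevels B) (n + 1) n
  -- A part with `n + 1 - c` levels has a root of height `n - c`. This shift and the loss of one
  -- level in the rounding make up the 2, hence the factor 4 in the claim.
  have h1 : (1 - ε) * Real.logb 3 B ≤ ((n - c : ℕ) : ℝ) + 2 := by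
    have h2 := logb_lt_partLevels_add_one B hB
    rw [Nat.succ_sub hle, Nat.cast_succ] at h
    nlinarith
  have hB0 : (0 : ℝ) < B := by positivity
  have h3 : (B : ℝ) ^ ((1 - ε) / Real.logb 2 3) = 2 ^ ((1 - ε) * Real.logb 3 B) := by
    rw [Real.rpow_def_of_pos hB0, Real.rpow_def_of_pos (by norm_num), Real.logb, Real.logb]
    congr 1
    have hlog2 : 0 < Real.log 2 := Real.log_pos (by norm_num)
    have hlog3 : 0 < Real.log 3 := Real.log_pos (by norm_num)
    field_simp
  rw [h3]
  calc (2 : ℝ) ^ ((1 - ε) * Real.logb 3 B) ≤ 2 ^ (((n - c : ℕ) : ℝ) + 2) :=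
        Real.rpow_le_rpow_of_exponent_le (by norm_num) h1
    _ = 4 * 2 ^ (n - c) := by
        rw [Real.rpow_add (by norm_num), Real.rpow_natCast]; norm_num; ring

/-! ### Persistent reads -/

namespace Store

variable {α : Type*}

/-- Blocks for the reads of all columns of an ephemeral block. -/
noncomputable def columnBlocks (S : Store α) (ε : ℝ) (A : Placement) (N B j v : ℕ)
    (t : STTree α) (g : ℕ) (e : ℕ → ℕ) (b : ℕ) : Finset ℕ :=
  insert (A.globals / B) ((((Finset.range S.U).filter fun i => e i = b).image (· / 2 ^ g)).biUnion
    -- The first column of each class modulo `2 ^ g`-quotients stands for the whole class; the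
    -- inserted block is that of the pointer `p`.
    fun y => S.leafBlocks ε A N B j (STTree.leafDirs (2 ^ g * y) v t))

/-- Columns of one ephemeral block differ by less than `β ≤ 4 * 2 ^ g`, so their quotients by `2 ^
g` differ by at most 4. This leaves at most nine classes of `100 * m` blocks, with `m` the number of
cuts, plus the block of `p`. If `g = S.logU`, there is a single class. -/
theorem card_columnBlocks_le (S : Store α) (ε : ℝ) (A : Placement) {N B : ℕ} (hB : 0 < B)
    (hNB : 3 ^ N ≤ 2 * B) (j v : ℕ) (t : STTree α) {g : ℕ} {β : ℝ} (hβ : 0 < β)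
    (hg : g = S.logU ∨ β ≤ 4 * 2 ^ g) {i : ℕ} (hi : i < S.U) :
    (S.columnBlocks ε A N B j v t g (blockOf β) (blockOf β i)).card ≤
      901 * (cuts ε N (S.logU + 1)).length := by
  have hcuts : 1 ≤ (cuts ε N (S.logU + 1)).length :=
    List.length_pos_of_mem (lastCut_mem_cuts ε N (S.logU + 1) 0)
  have himage : (((Finset.range S.U).filter fun i' => blockOf β i' = blockOf β i).image
      (· / 2 ^ g)).card ≤ 9 := by
    refine (Finset.card_le_card (t := Finset.Icc (i / 2 ^ g - 4) (i / 2 ^ g + 4)) ?_).trans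
      (by rw [Nat.card_Icc]; omega)
    intro y hy
    simp only [Finset.mem_image, Finset.mem_filter, Finset.mem_range] at hy
    obtain ⟨i', ⟨hi', he⟩, rfl⟩ := hy
    rw [Finset.mem_Icc]
    rcases hg with rfl | hg
    · have h1 : i / 2 ^ S.logU = 0 := Nat.div_eq_of_lt hi
      have h2 : i' / 2 ^ S.logU = 0 := Nat.div_eq_of_lt hi'
      rw [h1, h2]
      omega
    · have near : ∀ {a a' : ℕ}, blockOf β a = blockOf β a' → a / 2 ^ g ≤ a' / 2 ^ g + 4 := by
        intro a a' h
        have h1 : (blockOf β a : ℝ) ≤ a / β := Nat.floor_le (by positivity)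
        have h2 : (a : ℝ) / β < blockOf β a + 1 := Nat.lt_floor_add_one _
        have h3 : (blockOf β a' : ℝ) ≤ a' / β := Nat.floor_le (by positivity)
        have h4 : (a : ℝ) / β < a' / β + 1 := by rw [h] at h2; linarith
        rw [div_add_one hβ.ne', div_lt_div_iff_of_pos_right hβ] at h4
        have h5 : (a : ℝ) ≤ (a' + 4 * 2 ^ g : ℕ) := by push_cast; linarith
        have h6 : a ≤ a' + 4 * 2 ^ g := by exact_mod_cast h5
        rw [← Nat.add_mul_div_right a' 4 (Nat.two_pow_pos g)]
        exact Nat.div_le_div_right h6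
      exact ⟨Nat.sub_le_iff_le_add.2 (near he.symm), near he⟩
  refine (Finset.card_insert_le _ _).trans ?_
  have := (Finset.card_biUnion_le_card_mul _ _ _ fun y _ => S.card_leafBlocks_le ε A hB hNB j
    (STTree.leafDirs (2 ^ g * y) v t)).trans (Nat.mul_le_mul_right _ himage)
  omega

theorem IsValid.leafBlocks_subset_columnBlocks {S : Store α} (H : S.IsValid) (ε : ℝ)
    (A : Placement) {N B v i j : ℕ} {t : STTree α}
    (ht : S.trees[j]? = some t) (hc : ∀ i < S.U, t.rect.Contains i v) (hi : i < S.U)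
    (e : ℕ → ℕ) : S.leafBlocks ε A N B j (STTree.leafDirs i v t) ⊆
      S.columnBlocks ε A N B j v t (S.logU - lastCut ε N (S.logU + 1) S.logU) e (e i) := by
  obtain ⟨⟨T, hT⟩, hleft, -⟩ := H.isSTTree ht
  set g := S.logU - lastCut ε N (S.logU + 1) S.logU with hg
  have hle := lastCut_le ε N (S.logU + 1) S.logU
  have hi' : 2 ^ g * (i / 2 ^ g) < S.U := (Nat.mul_div_le _ _).trans_lt hi
  have h1 := hT.take_leafDirs_eq (g := g) (hc i hi) (hc _ hi') (by rw [hleft]; exact dvd_zero _)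
    (by rw [Nat.mul_div_cancel_left _ (Nat.two_pow_pos g)])
  -- Nodes of height `g` are exactly the roots of the lowest parts.
  rw [show S.logU - g = lastCut ε N (S.logU + 1) (S.logU + 1 - 1) by
    rw [Nat.add_sub_cancel]; omega] at h1
  have h2 : S.leafBlocks ε A N B j (STTree.leafDirs i v t) =
      S.leafBlocks ε A N B j (STTree.leafDirs (2 ^ g * (i / 2 ^ g)) v t) := by
    rw [leafBlocks, leafBlocks, partRoots_congr (Nat.succ_pos _) h1]
  rw [h2]
  refine subset_trans ?_ (Finset.subset_insert _ _)
  refine Finset.subset_biUnion_of_mem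
    (fun y => S.leafBlocks ε A N B j (STTree.leafDirs (2 ^ g * y) v t)) ?_
  exact Finset.mem_image_of_mem _ (Finset.mem_filter.2 ⟨Finset.mem_range.2 hi, rfl⟩)

theorem blockOf_natCast (B : ℕ) : blockOf (B : ℝ) = (· / B) := by
  funext a
  rw [blockOf, Nat.floor_div_eq_div]

/-- The time of persistent reads in terms of the number of parts on a way in the layout. -/
theorem IsValid.persistentTime_le {S : Store α} (H : S.IsValid) (h₀ : 0 < ε) (h₁ : ε < 1)
    (A : Placement) (p : Pointer) (hp : S.IsLeaf p) (before : List ℕ) {v : ℕ} (hv : 1 ≤ v)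
    (hv' : v ≤ S.vers) (X : List ℕ) (hX : ∀ i ∈ X, i < S.U) {M B K' : ℕ} (hB : 2 ≤ B)
    (hM : B ≤ M)
    (hK : 3 * K' * (901 * (cuts ε (partLevels B) (S.logU + 1)).length) ≤ M / B) :
    S.persistentTime ε A p before v X M B ≤
      10222 * (cuts ε (partLevels B) (S.logU + 1)).length *
        lruCost K' [] (X.map (blockOf ((B : ℝ) ^ ((1 - ε) / Real.logb 2 3)))) := by
  have hB0 : 0 < B := by omega
  have hN := one_le_partLevels B
  have hNB := pow_partLevels_le hB
  set N := partLevels B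
  set m := (cuts ε N (S.logU + 1)).length with hm
  set β := (B : ℝ) ^ ((1 - ε) / Real.logb 2 3) with hβdef
  have hβ : 0 < β := Real.rpow_pos_of_pos (by exact_mod_cast hB0) _
  rw [persistentTime, runtime, Nat.floor_div_eq_div, blockOf_natCast]
  have hK1 : 1 ≤ M / B := (Nat.one_le_div_iff hB0).2 hM
  generalize (before.map (· / B)).foldl touch [] = r
  cases X with
  | nil => simp [persistentReads, lruCost]
  | cons x X =>
    have hx := hX x List.mem_cons_self
    have hX' : ∀ y ∈ X, y < S.U := fun y hy => hX y (List.mem_cons_of_mem _ hy)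
    obtain ⟨s, hs, -⟩ := hp
    obtain ⟨t₀, ht₀, hs⟩ := Option.bind_eq_some_iff.1 hs
    have hp' : p.pos ∈ t₀.nodes := STTree.mem_nodes_of_at (by rw [hs]; rfl)
    obtain ⟨⟨j, t, ht, hc, hread⟩, hfirst⟩ :=
      H.lruCost_readBlocks_le ε A (i := x) hN hB0 hNB ht₀ hp' hv hv'
    rw [persistentReads, hread, List.flatMap_append, List.map_append,
      map_persistentReads H ε A ht hc x X hX']
    set g := S.logU - lastCut ε N (S.logU + 1) S.logU with hg
    have hg' : g = S.logU ∨ β ≤ 4 * 2 ^ g := by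
      rcases rpow_le_pow_sub_lastCut h₀ h₁ hB S.logU with h | h
      · exact .inl (by rw [hg, h, Nat.sub_zero])
      · exact .inr h
    -- The first read starts at an arbitrary leaf and is bounded on its own; from then on the
    -- pointer is the leaf of the preceding column.
    have main := lruCost_first_append_chainAccesses_le (m := 901 * m) (m₀ := 4816 * m)
      (R := fun i x => S.readBlocks ε A B v ⟨j, (STTree.leafDirs i v t).reverse⟩ x)
      (e := blockOf β) (F := S.columnBlocks ε A N B j v t g (blockOf β)) (P := (· < S.U))
      (fun i x hi hx y hy => by
        rw [Finset.mem_union]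
        rcases (H.mem_of_mem_readBlocks ε A hN ht (hc x hx)).2 y hy with h | h | h
        · exact .inl (h ▸ Finset.mem_insert_self _ _)
        · exact .inl (H.leafBlocks_subset_columnBlocks ε A ht hc hi _ h)
        · exact .inr (H.leafBlocks_subset_columnBlocks ε A ht hc hx _ h))
      (fun i hi => S.card_columnBlocks_le ε A hB0 hNB j v t hβ hg' hi)
      (fun i x hi hx r => (H.lruCost_readBlocks_le ε A hN hB0 hNB
        (p := ⟨j, (STTree.leafDirs i v t).reverse⟩) ht
        (STTree.reverse_leafDirs_mem_nodes i v t) hv hv').2 _ hK1 r)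
      hK (S.readBlocks ε A B v p x) (hfirst _ hK1) x X r hx hX'
    refine main.trans_eq ?_
    rw [show 4816 * m + 6 * (901 * m) = 10222 * m by ring]

end Store

end COPersistence

/-! ### The theorem -/

open COPersistence
theorem mainTheorem1 (ε : ℝ) (hε₀ : 0 < ε) (hε₁ : ε < 1) :
    ∃ c : ℝ, 1 ≤ c ∧
      ∀ (α : Type*) [Inhabited α] (writes : List (ℕ × α)) (S : Store α) (θ L : ℝ)
        (v : ℕ) (X : List ℕ) (A : Placement) (p : Pointer) (before : List ℕ) (M B : ℕ),
        S = Store.run writes → θ = (1 - ε) / Real.logb 2 3 →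
        2 ≤ B → B ≤ M → L = 1 + Real.logb B S.U →
        1 ≤ v → v ≤ writes.length → (∀ i ∈ X, i < S.U) → S.IsLeaf p →
        (S.persistentTime ε A p before v X M B : ℝ) ≤
          c * ephemeralTime X (M / (3 * c * (B : ℝ) ^ (1 - θ) * L)) ((B : ℝ) ^ θ) * L := by
  have hδ : 0 < min ε (1 - ε) := lt_min hε₀ (sub_pos.2 hε₁)
  have hδ1 : min ε (1 - ε) ≤ 1 := (min_le_left _ _).trans hε₁.le
  have h8 : 1 ≤ 8 / min ε (1 - ε) := by rw [le_div_iff₀ hδ]; linarith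
  -- The first factor is the cost per cut and ephemeral fetch, `4816 + 6 * 901`; the second one
  -- bounds the number of cuts in terms of `L`.
  refine ⟨10222 * (8 / min ε (1 - ε)), by linarith, ?_⟩
  set d := 8 / min ε (1 - ε)
  intro α _ writes S θ L v X A p before M B hS hθ hB hM hL hv hv' hX hp
  obtain ⟨hcur, hvers⟩ := Store.isCurrent_run writes
  rw [← hS] at hcur hvers
  have hcuts := length_cuts_le_logb hε₀ hε₁ hB S.logU
  have hcutsL : ((cuts ε (partLevels B) (S.logU + 1)).length : ℝ) ≤ d * L := by
    rw [hL]; exact hcuts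
  have hB0 : (0 : ℝ) < B := by positivity
  have hL1 : 1 ≤ L := by
    rw [hL]
    have : 0 ≤ Real.logb B S.U :=
      Real.logb_nonneg (by exact_mod_cast hB) (by exact_mod_cast S.U_pos)
    linarith
  rw [ephemeralTime, runtime, List.map_nil, List.foldl_nil]
  -- The powers of `B` combine, so the ephemeral cache has about `M / B` blocks divided by `3 * c *
  -- L`.
  have hdiv : (M : ℝ) / (3 * (10222 * d) * (B : ℝ) ^ (1 - θ) * L) / (B : ℝ) ^ θ =
      M / (3 * (10222 * d) * L * B) := by
    rw [div_div]
    congr 1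
    have : (B : ℝ) ^ (1 - θ) * (B : ℝ) ^ θ = B := by
      rw [← Real.rpow_add hB0, sub_add_cancel, Real.rpow_one]
    calc _ = 3 * (10222 * d) * L * ((B : ℝ) ^ (1 - θ) * (B : ℝ) ^ θ) := by ring
      _ = _ := by rw [this]
  rw [hdiv]
  set K' := ⌊(M : ℝ) / (3 * (10222 * d) * L * B)⌋₊ with hK'
  have hd : 0 < d := by linarith
  -- A phase fits into the cache, since the number of cuts is at most `d * L` and `901 ≤ 10222`.
  have hK : 3 * K' * (901 * (cuts ε (partLevels B) (S.logU + 1)).length) ≤ M / B := by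
    rw [Nat.le_div_iff_mul_le (by omega)]
    have h1 : (K' : ℝ) ≤ M / (3 * (10222 * d) * L * B) := Nat.floor_le (by positivity)
    rw [le_div_iff₀ (by positivity)] at h1
    have h2 : (3 * K' * (901 * (cuts ε (partLevels B) (S.logU + 1)).length) * B : ℝ) ≤ M := by
      calc _ ≤ (3 * K' * (901 * (d * L)) * B : ℝ) := by gcongr
        _ ≤ K' * (3 * (10222 * d) * L * B) := by
            have : 0 ≤ (K' : ℝ) * (d * L * B) := by positivity
            nlinarith
        _ ≤ M := h1
    exact_mod_cast h2
  have main := hcur.toIsValid.persistentTime_le hε₀ hε₁ A p hp before hv (hvers ▸ hv') X hX hB hM hK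
  rw [← hθ] at main
  calc (S.persistentTime ε A p before v X M B : ℝ) ≤ _ := Nat.cast_le.2 main
    _ ≤ _ := by
      push_cast
      set E := lruCost K' [] (X.map (blockOf ((B : ℝ) ^ θ)))
      calc _ ≤ 10222 * (d * L) * (E : ℝ) := by gcongr
        _ = _ := by ring
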